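/- Fix integers $N,T\ge 1$, Polish spaces $\mathcal X_t$, $\mathcal Y_t$ ($1\le t\le T$), and put $\mathcal X=\prod_{t}\mathcal X_t$, $\mathcal Y=\prod_t\mathcal Y_t$. A *filtered process* $\mathbb X$ with values in $\mathcal X$ consists of Polish spaces $\Omega_1,\dots,\Omega_T$, the space $\Omega=\Omega_{1:T}=\prod_t\Omega_t$ with its Borel $\sigma$-algebra and canonical filtration $\mathcal F_t=\sigma(\omega_{1:t})$, a Borel probability measure $\mathbb P(\mathrm d\omega)=\mathbb P_1(\mathrm d\omega_1)\otimes\mathbb P_{2,\omega_1}(\mathrm d\omega_2)\otimes\cdots\otimes\mathbb P_{T,\omega_{1:T-1}}(\mathrm d\omega_T)$ with a fixed version of the disintegration for which each $\omega_{1:t-1}\mapsto\mathbb P_{t,\omega_{1:t-1}}$ is weakly continuous, and a process $X=(X_t)_{t=1}^T$ adapted to $(\mathcal F_t)$, with $X_t$ valued in $\mathcal X_t$ and $X:\Omega\to\mathcal X$ continuous. Filtered processes $\mathbb Y$ with values in $\mathcal Y$ are defined in the same way; their class is $\mathrm{FP}(\mathcal Y)$. A coupling $\pi$ of $\mathbb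 P^{\mathbb X}$ and $\mathbb P^{\mathbb Y}$ on $\Omega^{\mathbb X}\times\Omega^{\mathbb Y}$ is *bicausal* if for every $t$, under $\pi$, $\omega^{\mathbb X}_{1:T}$ is conditionally independent of $\omega^{\mathbb Y}_{1:t}$ given $\omega^{\mathbb X}_{1:t}$, and $\omega^{\mathbb Y}_{1:T}$ is conditionally independent of $\omega^{\mathbb X}_{1:t}$ given $\omega^{\mathbb Y}_{1:t}$. For a cost $c:\mathcal X\times\mathcal Y\to\mathbb R$ let $\mathcal{AW}_c(\mathbb X,\mathbb Y)=\inf_\pi\mathbb E_\pi[c(X,Y)]$ over bicausal couplings $\pi$. Given filtered processes $\mathbb X^i=(\Omega^i,\mathbb P^i,X^i)$ with values in $\mathcal X$ and costs $c^i:\mathcal X\times\mathcal Y\to\mathbb R$, $1\le i\le N$, put $$B^{\rm bc}_{c^{1:N}}=\inf_{\mathbb Y\in\mathrm{FP}(\mathcal Y)}\ \sum_{i=1}^N\mathcal{AW}_{c^i}(\mathbb X^i,\mathbb Y)\in(-\infty,\infty].$$ Let $\mathcal Z_T=\mathcal Y_T$ and $\mathcal Z_t=\mathcal Y_t\times\mathcal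 P(\mathcal Z_{t+1})$ for $t<T$, where $\mathcal P$ denotes Borel probability measures with the weak topology. Write $z_t=(y_t,p_t)$ for $t<T$, $z_T=y_T$, $y=y_{1:T}$, and $\mathcal Z_{1:t}=\prod_{s\le t}\mathcal Z_s$. Let $\mathfrak G^i_{cts}$ be the set of functions $$G(\omega,z)=\sum_{t=2}^T\Big[a_t(\omega_{1:t},z_{1:t-1})-\int a_t(\omega_{1:t-1},\tilde\omega_t,z_{1:t-1})\,\mathbb P^i_{t,\omega_{1:t-1}}(\mathrm d\tilde\omega_t)\Big],\quad a_t\in C_b(\Omega^i_{1:t}\times\mathcal Z_{1:t-1}),$$ and $\mathfrak H^i_{cts}$ the set of functions $$H(\omega,z)=\sum_{t=2}^T\Big[a_t(\omega_{1:t-1},z_{1:t})-\int a_t(\omega_{1:t-1},z_{1:t-1},\tilde z_t)\,p_{t-1}(\mathrm d\tilde z_t)\Big],\quad a_t\in C_b(\Omega^i_{1:t-1}\times\mathcal Z_{1:t}).$$ Let $\Phi^{\rm bc}_{cts}$ be the set of tuples $(f^i)_{i=1}^N\in\prod_i C_b(\Omega^i_1)$ for which there exist $g^i\in C_b(\mathcal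 Z_1)$, $G^i\in\mathfrak G^i_{cts}$ and $H^i\in\mathfrak H^i_{cts}$, $1\le i\le N$, such that $\sum_{i=1}^N g^i=0$ on $\mathcal Z_1$ and, for all $i$, all $\omega\in\Omega^i$ and all $z\in\mathcal Z_{1:T}$, $$f^i(\omega_1)+g^i(z_1)\le c^i(X^i(\omega),y)+G^i(\omega,z)+H^i(\omega,z).$$ **Theorem (duality for bicausal barycenters).** Assume that $\mathcal Y$ is compact and that every $c^i$, $1\le i\le N$, is lower-semicontinuous and bounded from below. Then, as elements of $(-\infty,\infty]$, $$B^{\rm bc}_{c^{1:N}}=\sup_{(f^i)\in\Phi^{\rm bc}_{cts}}\ \sum_{i=1}^N\int f^i(\omega_1)\,\mathbb P^i(\mathrm d\omega).$$ -/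

import Mathlib

open MeasureTheory ProbabilityTheory
open scoped ENNReal BoundedContinuousFunction

universe u v w

namespace BicausalBarycenter

/-! ### Paths and filtered processes

Time runs through `Fin T`, so that `0 : Fin T` is the first date. For a family `E` of spaces,
`Path E` is `E_{1:T}` and `Past E t` is the product of the `E s` over the dates `s` strictly
before `t`. -/

/-- The space of whole paths. -/
abbrev Path {T : ℕ} (E : Fin T → Type u) : Type u := ∀ t, E t

/-- The space of paths strictly before date `t`. -/
abbrev Past {T : ℕ} (E : Fin T → Type u) (t : Fin T) : Type u := ∀ s : Set.Iio t, E s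

/-- Restriction of a path to the dates strictly before `t`. -/
def past {T : ℕ} {E : Fin T → Type u} (t : Fin T) (x : Path E) : Past E t := fun s => x s

/-- A filtered process with values in `∏ t, 𝒳 t`: a product of Polish spaces with its canonical
filtration, a Borel probability law with successive disintegration kernels that are weakly
continuous, and a continuous adapted process. The kernel at the first date has a one-point source,
it is the law of the first coordinate. -/
structure FilteredProcess {T : ℕ} (𝒳 : Fin T → Type u) [∀ t, TopologicalSpace (𝒳 t)]
    [∀ t, MeasurableSpace (𝒳 t)] where
  /-- the factors of the sample space -/
  Ω : Fin T → Type v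
  [topΩ : ∀ t, TopologicalSpace (Ω t)]
  [polishΩ : ∀ t, PolishSpace (Ω t)]
  [measΩ : ∀ t, MeasurableSpace (Ω t)]
  [borelΩ : ∀ t, BorelSpace (Ω t)]
  /-- the probability measure on the sample space -/
  law : Measure (Path Ω)
  [probLaw : IsProbabilityMeasure law]
  /-- the successive disintegration kernels of `law` -/
  kernel : ∀ t, Kernel (Past Ω t) (Ω t)
  [markov : ∀ t, IsMarkovKernel (kernel t)]
  disintegration : ∀ t,
    law.map (fun ω => (past t ω, ω t)) = (law.map (past t)) ⊗ₘ (kernel t)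
  kernel_continuous : ∀ t,
    Continuous (Y := ProbabilityMeasure (Ω t)) (fun h : Past Ω t => ⟨kernel t h, inferInstance⟩)
  /-- the process -/
  X : ∀ t, Path Ω → 𝒳 t
  X_continuous : ∀ t, Continuous (X t)
  X_adapted : ∀ t, Measurable[Filtration.piLE (X := Ω) t] (X t)

attribute [instance] FilteredProcess.topΩ FilteredProcess.polishΩ FilteredProcess.measΩ
  FilteredProcess.borelΩ FilteredProcess.probLaw FilteredProcess.markov

section Transport

variable {T : ℕ} {𝒳 : Fin T → Type u} [∀ t, TopologicalSpace (𝒳 t)] [∀ t, MeasurableSpace (𝒳 t)]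
  {𝒴 : Fin T → Type w} [∀ t, TopologicalSpace (𝒴 t)] [∀ t, MeasurableSpace (𝒴 t)]

/-- The path of the process, as a map from the sample space to `∏ t, 𝒳 t`. -/
def FilteredProcess.path (𝕏 : FilteredProcess.{u, v} 𝒳) (ω : Path 𝕏.Ω) : Path 𝒳 :=
  fun t => 𝕏.X t ω

/-! ### Bicausal couplings and bicausal transport -/

/-- Probability measures on the product of the two sample spaces with the prescribed marginals. -/
structure IsCoupling (𝕏 : FilteredProcess.{u, v} 𝒳) (𝕐 : FilteredProcess.{w, w} 𝒴)
    (π : Measure (Path 𝕏.Ω × Path 𝕐.Ω)) : Prop where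
  map_fst : π.map Prod.fst = 𝕏.law
  map_snd : π.map Prod.snd = 𝕐.law

/-- For every date `t`, the whole first coordinate is, under `π`, conditionally independent of the
second coordinate up to date `t`, given the first coordinate up to date `t`. -/
def IsCausal {A : Fin T → Type u} {B : Fin T → Type w}
    [∀ t, MeasurableSpace (A t)] [∀ t, StandardBorelSpace (A t)]
    [∀ t, MeasurableSpace (B t)] [∀ t, StandardBorelSpace (B t)]
    (π : Measure (Path A × Path B)) [IsFiniteMeasure π] : Prop :=
  ∀ t : Fin T, CondIndep
    ((Filtration.piLE (X := A) t).comap Prod.fst)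
    ((MeasurableSpace.pi : MeasurableSpace (Path A)).comap Prod.fst)
    ((Filtration.piLE (X := B) t).comap Prod.snd)
    ((MeasurableSpace.comap_mono ((Filtration.piLE (X := A)).le t)).trans
      measurable_fst.comap_le)
    π

/-- The set of bicausal couplings of `𝕏` and `𝕐`. -/
def bicausalCouplings (𝕏 : FilteredProcess.{u, v} 𝒳) (𝕐 : FilteredProcess.{w, w} 𝒴) :
    Set (ProbabilityMeasure (Path 𝕏.Ω × Path 𝕐.Ω)) :=
  {π | IsCoupling 𝕏 𝕐 π ∧ IsCausal (π : Measure (Path 𝕏.Ω × Path 𝕐.Ω)) ∧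
    IsCausal ((π : Measure (Path 𝕏.Ω × Path 𝕐.Ω)).map Prod.swap)}

/-- The expectation of a real function, with values in the extended reals: integral of the positive
part minus integral of the negative part. -/
noncomputable def expectation {S : Type*} [MeasurableSpace S] (μ : Measure S) (f : S → ℝ) : EReal :=
  ((∫⁻ x, ENNReal.ofReal (f x) ∂μ : ℝ≥0∞) : EReal) -
    ((∫⁻ x, ENNReal.ofReal (-f x) ∂μ : ℝ≥0∞) : EReal)

/-- The bicausal transport value of `𝕏` and `𝕐` for the cost `c`. -/
noncomputable def bicausalValue (c : Path 𝒳 × Path 𝒴 → ℝ)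
    (𝕏 : FilteredProcess.{u, v} 𝒳) (𝕐 : FilteredProcess.{w, w} 𝒴) : EReal :=
  ⨅ π ∈ bicausalCouplings 𝕏 𝕐,
    expectation (π : Measure (Path 𝕏.Ω × Path 𝕐.Ω)) (fun p => c (𝕏.path p.1, 𝕐.path p.2))

/-- The value of the bicausal barycenter problem. -/
noncomputable def barycenterValue {N : ℕ} (c : Fin N → Path 𝒳 × Path 𝒴 → ℝ)
    (𝕏 : Fin N → FilteredProcess.{u, v} 𝒳) : EReal :=
  ⨅ 𝕐 : FilteredProcess.{w, w} 𝒴, ∑ i, bicausalValue (c i) (𝕏 i) 𝕐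

end Transport

/-! ### The canonical space of the information process -/

/-- Borel probability measures on a topological space, with the weak topology. -/
def BorelLaw (E : Type w) [TopologicalSpace E] : Type w := @ProbabilityMeasure E (borel E)

noncomputable instance (E : Type w) [TopologicalSpace E] : TopologicalSpace (BorelLaw E) :=
  @ProbabilityMeasure.instTopologicalSpace E (borel E) _ (@OpensMeasurableSpace.mk E _ (borel E) le_rfl)

section Information

variable {T : ℕ} (𝒴 : Fin T → Type w) [∀ t, TopologicalSpace (𝒴 t)]

/-- The information space at date `t` when `k` dates are still to come after `t`: it is `𝒴 t` if
`k = 0`, and `𝒴 t × 𝒫(information space at date t + 1)` otherwise. -/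
noncomputable def infoSpace : (k t : ℕ) → t + k < T → TopCat.{w}
  | 0, t, h => TopCat.of (𝒴 ⟨t, by omega⟩)
  | k + 1, t, h => TopCat.of (𝒴 ⟨t, by omega⟩ × BorelLaw (infoSpace k (t + 1) (by omega)))

/-- The spaces `𝒵_T = 𝒴_T` and `𝒵_t = 𝒴_t × 𝒫(𝒵_{t+1})`. -/
def Info (t : Fin T) : Type w := infoSpace 𝒴 (T - 1 - t) t (by omega)

noncomputable instance (t : Fin T) : TopologicalSpace (Info 𝒴 t) :=
  (infoSpace 𝒴 (T - 1 - t) t (by omega)).str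

noncomputable instance (t : Fin T) : MeasurableSpace (Info 𝒴 t) := borel (Info 𝒴 t)

instance (t : Fin T) : BorelSpace (Info 𝒴 t) := ⟨rfl⟩

variable {𝒴}

/-- The state component of a point of an information space. -/
def infoSpace.state : (k t : ℕ) → (h : t + k < T) → infoSpace 𝒴 k t h → 𝒴 ⟨t, by omega⟩
  | 0, _, _, z => z
  | _ + 1, _, _, z => z.1

/-- The law component of a point of an information space before the last date. -/
def infoSpace.next : (k t : ℕ) → (h : t + k < T) → (hk : 0 < k) → infoSpace 𝒴 k t h →
    BorelLaw (infoSpace 𝒴 (k - 1) (t + 1) (by omega))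
  | _ + 1, _, _, _, z => z.2

/-- The component `y_t` of `z_t ∈ 𝒵_t`. -/
def Info.state {t : Fin T} (z : Info 𝒴 t) : 𝒴 t :=
  infoSpace.state (T - 1 - t) t (by omega) z

/-- The component `p_t ∈ 𝒫(𝒵_{t+1})` of `z_t ∈ 𝒵_t`, for `t` before the last date. -/
def Info.next {t : ℕ} (h : t + 1 < T) (z : Info 𝒴 ⟨t, by omega⟩) :
    ProbabilityMeasure (Info 𝒴 ⟨t + 1, h⟩) :=
  infoSpace.next (T - 1 - t) t (by omega) (by omega) z

/-- The path `y_{1:T}` of the state components of `z_{1:T}`. -/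
def infoState (z : Path (Info 𝒴)) : Path 𝒴 := fun t => (z t).state

/-- The canonical kernel: for a date `t` other than the first, the law of `z_t` given the past
`z_{1:t-1}` is the law component `p_{t-1}` of `z_{t-1}`. -/
def infoKernel : (t : Fin T) → 0 < t.val → Past (Info 𝒴) t → ProbabilityMeasure (Info 𝒴 t)
  | ⟨0, _⟩, h, _ => absurd h (lt_irrefl 0)
  | ⟨t + 1, ht⟩, _, z => Info.next ht (z ⟨⟨t, by omega⟩, Nat.lt_succ_self t⟩)

end Information

/-! ### The dual problem -/

section Dual

variable {T : ℕ} {𝒳 : Fin T → Type u} [∀ t, TopologicalSpace (𝒳 t)] [∀ t, MeasurableSpace (𝒳 t)]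
  (𝒴 : Fin T → Type w) [∀ t, TopologicalSpace (𝒴 t)]

/-- The continuous test functions
`G(ω, z) = ∑_{t ≥ 2} a_t(ω_{1:t}, z_{1:t-1}) - ∫ a_t(ω_{1:t-1}, ω', z_{1:t-1}) ℙ_t(ω_{1:t-1}; dω')`
with every `a_t` bounded and continuous. -/
def testG (𝕏 : FilteredProcess.{u, v} 𝒳) : Set (Path 𝕏.Ω → Path (Info 𝒴) → ℝ) :=
  {G | ∃ a : ∀ t : Fin T, ((Past 𝕏.Ω t × 𝕏.Ω t) × Past (Info 𝒴) t) →ᵇ ℝ,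
    ∀ ω z, G ω z = ∑ t : {t : Fin T // 0 < t.val},
      (a t ((past t ω, ω t), past t z) -
        ∫ ω', a t ((past t ω, ω'), past t z) ∂(𝕏.kernel t (past t ω)))}

/-- The continuous test functions
`H(ω, z) = ∑_{t ≥ 2} a_t(ω_{1:t-1}, z_{1:t}) - ∫ a_t(ω_{1:t-1}, z_{1:t-1}, z') p_{t-1}(dz')`
with every `a_t` bounded and continuous. -/
def testH (𝕏 : FilteredProcess.{u, v} 𝒳) : Set (Path 𝕏.Ω → Path (Info 𝒴) → ℝ) :=
  {H | ∃ a : ∀ t : Fin T, (Past 𝕏.Ω t × (Past (Info 𝒴) t × Info 𝒴 t)) →ᵇ ℝ,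
    ∀ ω z, H ω z = ∑ t : {t : Fin T // 0 < t.val},
      (a t (past t ω, (past t z, z t)) -
        ∫ z', a t (past t ω, (past t z, z'))
          ∂(infoKernel t.1 t.2 (past t z) : Measure (Info 𝒴 t)))}

variable {𝒴} [NeZero T]

/-- The admissible tuples `(f^1, …, f^N)` of bounded continuous potentials of the first date. -/
def dualPotentials {N : ℕ} (c : Fin N → Path 𝒳 × Path 𝒴 → ℝ)
    (𝕏 : Fin N → FilteredProcess.{u, v} 𝒳) : Set (∀ i, (𝕏 i).Ω 0 →ᵇ ℝ) :=
  {f | ∃ g : Fin N → (Info 𝒴 (0 : Fin T) →ᵇ ℝ), (∀ z, ∑ i, g i z = 0) ∧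
    ∀ i, ∃ G ∈ testG 𝒴 (𝕏 i), ∃ H ∈ testH 𝒴 (𝕏 i), ∀ ω z,
      f i (ω 0) + g i (z 0) ≤ c i ((𝕏 i).path ω, infoState z) + G ω z + H ω z}

/-- The value of the dual problem. -/
noncomputable def dualValue {N : ℕ} (c : Fin N → Path 𝒳 × Path 𝒴 → ℝ)
    (𝕏 : Fin N → FilteredProcess.{u, v} 𝒳) : EReal :=
  ⨆ f ∈ dualPotentials c 𝕏, ((∑ i, ∫ ω, f i (ω 0) ∂(𝕏 i).law : ℝ) : EReal)

end Dual

end BicausalBarycenter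

/-! Every process `𝕐` is replaced by its information process: going backward in time, `z_t` consists
of the state at `t` and the conditional law of `z_{t+1}`. Along this process the kernel is
canonical, since the law of the next point is a component of the present one. The unknown `𝕐`
therefore becomes an unknown law on the fixed compact space `Path (Info 𝒴)`, and bicausality becomes
a family of linear conditions: the integrals of all functions in `testG` and `testH` vanish.

For weak duality, a bicausal coupling is pushed forward by `Prod.map id 𝕐.infoPath`. Causality in
each direction says that the next coordinate, given both pasts, follows the kernel of its own
process (`NonanticipativeAt`). Hence `G` and `H` integrate to zero, and the terms `g i` cancel in
the sum because all couplings share the law of `𝕐`.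

For strong duality, take a real `α` above the dual value and enlarge the dual set to
`dominatedTuples`, whose members `ψ i` may depend on `(ω, z)`. Minimizing `ψ i` over `z` gives a
continuous function of `ω`, which equals a function of `ω 0` plus an element of `testG`
(`exists_eq_add_testG`). So for each such tuple some laws with first marginals `(𝕏 i).law` have
pairing at most `α` (`exists_sum_integral_le`). These laws form a compact set with convex image
under `pairing`, and the minimax theorem `exists_forall_le_of_convex` yields a single tuple `π` that
works for all `ψ`.

Adding a real multiple of a term `G` or `H`, or of a tuple of functions of `z 0` with zero sum, does
not leave the dominated set, so `π` annihilates all of these (`pairing_eq_zero`). Consequently each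
`π i` is nonanticipative in both directions, and all share the same marginal at `z 0`. The canonical
kernels then force the same law `ν` of the whole path `z`, and the `π i` are bicausal couplings with
the canonical process of `ν`. Monotone approximation of the costs by bounded continuous functions
bounds the total cost by `α`. -/

open Set Filter Topology TopologicalSpace

namespace BicausalBarycenter

/-! ### Minimax -/

section Minimax

variable {V X : Type*} [AddCommGroup V] [Module ℝ V] [TopologicalSpace X]

/-- A finite-dimensional form of the minimax theorem. -/
lemma exists_forall_le_of_finset {K : Set X} (hK : IsCompact K) (hne : K.Nonempty)
    (φ : X → V →ₗ[ℝ] ℝ) (hconv : Convex ℝ (φ '' K)) {Ψ : Set V} (hΨ : Convex ℝ Ψ)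
    (hcont : ∀ ψ, Continuous fun x => φ x ψ) {α : ℝ} (h : ∀ ψ ∈ Ψ, ∃ x ∈ K, φ x ψ ≤ α)
    (u : Finset Ψ) : ∃ x ∈ K, ∀ ψ ∈ u, φ x ψ ≤ α := by
  classical
  by_contra! hcon
  -- Only the values at the finitely many points of `u` matter: the compact convex image in `u → ℝ`
  -- would miss the closed orthant `Q`, and the two can be strictly separated.
  let L : (V →ₗ[ℝ] ℝ) →ₗ[ℝ] (u → ℝ) :=
    { toFun := fun l j => l j.1.1
      map_add' := fun _ _ => rfl
      map_smul' := fun _ _ => rfl }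
  have hLc : Continuous fun x => L (φ x) := continuous_pi fun j => hcont _
  have hC : IsCompact (L '' (φ '' K)) := by
    rw [← image_comp]
    exact hK.image hLc
  let Q : Set (u → ℝ) := {y | ∀ j, y j ≤ α}
  have hQconv : Convex ℝ Q := by
    intro x hx y hy a b ha hb hab j
    have h1 := mul_le_mul_of_nonneg_left (hx j) ha
    have h2 := mul_le_mul_of_nonneg_left (hy j) hb
    have : a * α + b * α = α := by rw [← add_mul, hab, one_mul]
    simp only [Pi.add_apply, Pi.smul_apply, smul_eq_mul]
    linarith
  have hQcl : IsClosed Q := by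
    simp only [Q, ofPred_forall]
    exact isClosed_iInter fun j => isClosed_le (continuous_apply j) continuous_const
  have hdisj : Disjoint (L '' (φ '' K)) Q := by
    rw [Set.disjoint_left]
    rintro _ ⟨_, ⟨x, hx, rfl⟩, rfl⟩ hq
    obtain ⟨ψ, hψ, hlt⟩ := hcon x hx
    exact absurd (hq ⟨ψ, hψ⟩) (not_le.2 hlt)
  obtain ⟨f, a, b, hfa, hab, hfb⟩ :=
    geometric_hahn_banach_compact_closed (hconv.linear_image L) hC hQconv hQcl hdisj
  let e : u → (u → ℝ) := fun j => Pi.single j 1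
  have hf : ∀ y : u → ℝ, f y = ∑ j, y j * f (e j) := by
    intro y
    conv_lhs => rw [pi_eq_sum_univ' y]
    simp [e, map_sum]
  -- `Q` is unbounded downward in each coordinate while `f` is bounded below on it, so no
  -- coefficient of `f` can be positive.
  have hneg : ∀ j, f (e j) ≤ 0 := by
    intro j
    by_contra! hpos
    have key : ∀ t : ℝ, 0 ≤ t → b < f (fun _ => α) - t * f (e j) := by
      intro t ht
      have hmem : (fun _ => α) - t • e j ∈ Q := by
        intro i
        have : 0 ≤ (t • e j) i := by
          simp only [e, Pi.smul_apply, smul_eq_mul, Pi.single_apply]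
          split_ifs <;> simp [ht]
        simp only [Pi.sub_apply]
        linarith
      simpa using hfb _ hmem
    have h0 := key 0 le_rfl
    have h1 := key ((f (fun _ => α) - b) / f (e j)) (by
      apply div_nonneg _ hpos.le
      linarith)
    rw [div_mul_cancel₀ _ hpos.ne'] at h1
    linarith
  obtain ⟨x₀, hx₀⟩ := hne
  set Λ := ∑ j, -f (e j) with hΛ
  have hΛ0 : 0 ≤ Λ := Finset.sum_nonneg fun j _ => neg_nonneg.2 (hneg j)
  -- If the total weight were zero then `f = 0`, which cannot strictly separate two nonempty sets.
  have hΛpos : 0 < Λ := by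
    rcases hΛ0.lt_or_eq with h0 | h0
    · exact h0
    have hz : ∀ j, f (e j) = 0 := by
      intro j
      have := (Finset.sum_eq_zero_iff_of_nonneg
        (fun j _ => neg_nonneg.2 (hneg j))).1 h0.symm j (Finset.mem_univ j)
      linarith
    have hf0 : ∀ y, f y = 0 := fun y => by simp [hf y, hz]
    have h1 := hfa _ ⟨_, ⟨x₀, hx₀, rfl⟩, rfl⟩
    have h2 := hfb (fun _ => α) (fun _ => le_rfl)
    rw [hf0] at h1 h2
    linarith
  -- The normalized coefficients of the separating functional pick the convex combination of the `ψ`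
  -- at which the hypothesis `h` is contradicted.
  let wt : u → ℝ := fun j => -f (e j) / Λ
  have hw : ∑ j, wt j = 1 := by
    rw [← Finset.sum_div, div_self hΛpos.ne']
  have hψ : ∑ j, wt j • (j.1.1 : V) ∈ Ψ :=
    hΨ.sum_mem (fun j _ => div_nonneg (neg_nonneg.2 (hneg j)) hΛ0) hw fun j _ => j.1.2
  obtain ⟨x, hx, hle⟩ := h _ hψ
  have h1 := hfa _ ⟨_, ⟨x, hx, rfl⟩, rfl⟩
  have h2 := hfb (fun _ => α) (fun _ => le_rfl)
  have h3 : f (L (φ x)) = -(Λ * φ x (∑ j, wt j • (j.1.1 : V))) := by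
    rw [hf, map_sum, Finset.mul_sum, ← Finset.sum_neg_distrib]
    refine Finset.sum_congr rfl fun j _ => ?_
    simp only [L, wt, LinearMap.coe_mk, AddHom.coe_mk, map_smul, smul_eq_mul]
    field_simp
  have h4 : f (fun _ => α) = -(Λ * α) := by
    rw [hf, hΛ, Finset.sum_mul, ← Finset.sum_neg_distrib]
    exact Finset.sum_congr rfl fun j _ => by ring
  have h5 := mul_le_mul_of_nonneg_left hle hΛ0
  linarith

/-- A minimax theorem for a compact set and a convex family of continuous affine functions. -/
lemma exists_forall_le_of_convex {K : Set X} (hK : IsCompact K) (hne : K.Nonempty)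
    (φ : X → V →ₗ[ℝ] ℝ) (hconv : Convex ℝ (φ '' K)) {Ψ : Set V} (hΨ : Convex ℝ Ψ)
    (hcont : ∀ ψ, Continuous fun x => φ x ψ) {α : ℝ} (h : ∀ ψ ∈ Ψ, ∃ x ∈ K, φ x ψ ≤ α) :
    ∃ x ∈ K, ∀ ψ ∈ Ψ, φ x ψ ≤ α := by
  obtain ⟨x, hx, hx'⟩ := hK.inter_iInter_nonempty (fun ψ : Ψ => {x | φ x ψ ≤ α})
    (fun ψ => isClosed_le (hcont ψ) continuous_const) (fun u => by
      obtain ⟨x, hx, h'⟩ := exists_forall_le_of_finset hK hne φ hconv hΨ hcont h u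
      exact ⟨x, hx, by simpa using h'⟩)
  exact ⟨x, hx, fun ψ hψ => mem_iInter.1 hx' ⟨ψ, hψ⟩⟩

end Minimax

/-! ### Lower semicontinuous functions -/

/-- A lower semicontinuous function bounded from below on a metrizable space is the limit of an
increasing sequence of bounded continuous functions. -/
lemma exists_monotone_tendsto_of_lowerSemicontinuous {E : Type*} [TopologicalSpace E]
    [MetrizableSpace E] {c : E → ℝ} (hc : LowerSemicontinuous c) (hb : BddBelow (range c)) :
    ∃ f : ℕ → E →ᵇ ℝ, (∀ n x, f n x ≤ c x) ∧ (∀ x, Monotone fun n => f n x) ∧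
      ∀ x, Tendsto (fun n => f n x) atTop (𝓝 (c x)) := by
  let := metrizableSpaceMetric E
  obtain ⟨b, hb⟩ := hb
  let C := max (-b) 0
  have hC : ∀ x, -C ≤ c x := fun x => by
    have := hb (mem_range_self x)
    have := le_max_left (-b) 0
    change -max (-b) 0 ≤ _
    linarith
  have hC0 : 0 ≤ C := le_max_right _ _
  -- Lipschitz regularization by infimal convolution; truncating at `n` makes it bounded above.
  let g : ℕ → E → ℝ := fun n x => ⨅ y, (min (c y) n + n * dist x y)
  have hlow : ∀ (n : ℕ) x y, -C ≤ min (c y) n + n * dist x y := fun n x y => by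
    have h1 : -C ≤ min (c y) n :=
      le_min (hC y) ((neg_nonpos.2 hC0).trans (Nat.cast_nonneg n))
    have : 0 ≤ n * dist x y := by positivity
    linarith
  have hbd : ∀ (n : ℕ) x, BddBelow (range fun y => min (c y) n + n * dist x y) :=
    fun n x => ⟨-C, by rintro _ ⟨y, rfl⟩; exact hlow n x y⟩
  have hle : ∀ n x, g n x ≤ min (c x) n := fun n x => by
    simpa using ciInf_le (hbd n x) x
  have hge : ∀ n x, -C ≤ g n x := fun n x => by
    have : Nonempty E := ⟨x⟩
    exact le_ciInf fun y => hlow n x y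
  have hlip : ∀ n : ℕ, LipschitzWith n (g n) := fun n => by
    refine LipschitzWith.of_le_add_mul _ fun x y => ?_
    have : Nonempty E := ⟨x⟩
    rw [← sub_le_iff_le_add]
    refine le_ciInf fun z => ?_
    have h1 := ciInf_le (hbd n x) z
    have h2 := mul_le_mul_of_nonneg_left (dist_triangle x y z) (Nat.cast_nonneg (α := ℝ) n)
    simp only [NNReal.coe_natCast]
    change g n x ≤ _ at h1
    linarith
  refine ⟨fun n => BoundedContinuousFunction.ofNormedAddCommGroup (g n) (hlip n).continuous
    (max C n) fun x => ?_, fun n x => (hle n x).trans (min_le_left _ _), fun x m n hmn => ?_,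
    fun x => ?_⟩
  · rw [Real.norm_eq_abs, abs_le]
    exact ⟨(neg_le_neg (le_max_left _ _)).trans (hge n x),
      ((hle n x).trans (min_le_right _ _)).trans (le_max_right _ _)⟩
  · have : Nonempty E := ⟨x⟩
    change g m x ≤ g n x
    have : (m : ℝ) ≤ n := by exact_mod_cast hmn
    exact ciInf_mono (hbd m x) fun y => by gcongr
  · change Tendsto (fun n => g n x) atTop (𝓝 (c x))
    refine tendsto_order.2 ⟨fun a ha => ?_, fun a ha => Eventually.of_forall fun n =>
      ((hle n x).trans (min_le_left _ _)).trans_lt ha⟩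
    obtain ⟨a', ha, ha'⟩ := exists_between ha
    obtain ⟨δ, hδ, hball⟩ := Metric.mem_nhds_iff.1 (hc x a' ha')
    -- The first bound keeps the truncation above `a'` inside the ball of radius `δ`; the second
    -- makes the penalty `n * δ` at least `c x + C` outside it, which offsets the lower bound `-C`.
    filter_upwards [eventually_ge_atTop (⌈max (c x) ((c x + C) / δ)⌉₊)] with n hn
    have hn' := Nat.ceil_le.1 hn
    have h1 := (le_max_left _ _).trans hn'
    have h2 := (le_max_right _ _).trans hn'
    rw [div_le_iff₀ hδ] at h2
    have : Nonempty E := ⟨x⟩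
    refine ha.trans_le (le_ciInf fun y => ?_)
    by_cases hy : dist x y < δ
    · have hy' : a' < c y := hball (by rwa [Metric.mem_ball, dist_comm])
      have : a' ≤ min (c y) n := le_min hy'.le (ha'.le.trans h1)
      have : 0 ≤ n * dist x y := by positivity
      linarith
    · have h3 : -C ≤ min (c y) n :=
        le_min (hC y) ((neg_nonpos.2 hC0).trans (Nat.cast_nonneg n))
      have h4 := mul_le_mul_of_nonneg_left (not_lt.1 hy) (Nat.cast_nonneg (α := ℝ) n)
      linarith

/-! ### Weakly continuous kernels -/

section WeakKernels

variable {S E : Type*} [TopologicalSpace S] [MeasurableSpace S] [TopologicalSpace E]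
  [MeasurableSpace E]

/-- The integral is that of `a` against the product of the Dirac mass at `s` with `κ s`, and
products of probability measures are weakly continuous in both factors. -/
lemma continuous_integral_of_continuous [PseudoMetrizableSpace S] [SecondCountableTopology S]
    [OpensMeasurableSpace S] [PseudoMetrizableSpace E] [SecondCountableTopology E]
    [OpensMeasurableSpace E] {κ : S → ProbabilityMeasure E} (hκ : Continuous κ)
    (a : S × E →ᵇ ℝ) : Continuous fun s => ∫ e, a (s, e) ∂(κ s : Measure E) := by
  have h : Continuous fun s => (diracProba s).prod (κ s) :=
    ProbabilityMeasure.continuous_prod.comp (continuous_diracProba.prodMk hκ)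
  convert (ProbabilityMeasure.continuous_integral_boundedContinuousFunction a).comp h with s
  have hs : (((diracProba s).prod (κ s) : ProbabilityMeasure (S × E)) : Measure (S × E)) =
      (κ s : Measure E).map (Prod.mk s) := by
    rw [ProbabilityMeasure.toMeasure_prod]
    exact Measure.dirac_prod s
  rw [Function.comp_apply, hs,
    integral_map (by fun_prop) (a.continuous.aestronglyMeasurable)]

/-- By the portmanteau theorem the mass of an open set is lower semicontinuous in the parameter, and
open sets form a generating π-system. -/
lemma measurable_of_continuous_probabilityMeasure [OpensMeasurableSpace S]
    [HasOuterApproxClosed E] [BorelSpace E] {κ : S → ProbabilityMeasure E} (hκ : Continuous κ) :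
    Measurable fun s => (κ s : Measure E) := by
  refine Measurable.measure_of_isPiSystem_of_isProbabilityMeasure (S := {s : Set E | IsOpen s})
    (BorelSpace.measurable_eq.trans rfl) isPiSystem_isOpen fun U hU => ?_
  refine LowerSemicontinuous.measurable fun s y hy => ?_
  have := ProbabilityMeasure.le_liminf_measure_open_of_tendsto (hκ.tendsto s) hU
  exact eventually_lt_of_lt_liminf (hy.trans_le this)

end WeakKernels

/-- Prokhorov's theorem: the first marginal is a single tight law and the second lives on a compact
space, so the set is tight; it is closed because taking a marginal is continuous. -/
lemma isCompact_setOf_map_fst_eq {A B : Type*} [TopologicalSpace A] [PolishSpace A]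
    [MeasurableSpace A] [BorelSpace A] [TopologicalSpace B] [CompactSpace B] [MetrizableSpace B]
    [SecondCountableTopology B] [MeasurableSpace B] [BorelSpace B] (P : Measure A)
    [IsProbabilityMeasure P] :
    IsCompact {π : ProbabilityMeasure (A × B) |
      (π : Measure (A × B)).map Prod.fst = P} := by
  have hcl : IsClosed {π : ProbabilityMeasure (A × B) |
      (π : Measure (A × B)).map Prod.fst = P} := by
    have : {π : ProbabilityMeasure (A × B) | (π : Measure (A × B)).map Prod.fst = P} =
        {π | π.map (f := Prod.fst) measurable_fst.aemeasurable = ⟨P, inferInstance⟩} := by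
      ext π
      exact ⟨fun h => Subtype.ext h, fun h => congrArg Subtype.val h⟩
    rw [this]
    exact isClosed_eq (ProbabilityMeasure.continuous_map continuous_fst) continuous_const
  rw [← hcl.closure_eq]
  apply isCompact_closure_of_isTightMeasureSet
  refine IsTightMeasureSet.prodMk ?_ IsTightMeasureSet.of_compactSpace
  refine (isTightMeasureSet_singleton (μ := P)).subset ?_
  rintro _ ⟨_, ⟨π, hπ, rfl⟩, rfl⟩
  exact hπ

/-! ### Expectations in the extended reals -/

lemma expectation_mono {S : Type*} [MeasurableSpace S] (μ : Measure S) {f g : S → ℝ}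
    (h : ∀ x, f x ≤ g x) : expectation μ f ≤ expectation μ g := by
  refine EReal.sub_le_sub ?_ ?_
  · exact_mod_cast lintegral_mono fun x => ENNReal.ofReal_le_ofReal (h x)
  · exact_mod_cast lintegral_mono fun x => ENNReal.ofReal_le_ofReal (neg_le_neg (h x))

lemma expectation_eq_integral {S : Type*} [MeasurableSpace S] {μ : Measure S} {f : S → ℝ}
    (hf : Integrable f μ) : expectation μ f = ((∫ x, f x ∂μ : ℝ) : EReal) := by
  have h1 : ∫⁻ x, ENNReal.ofReal (f x) ∂μ ≠ ∞ := hf.lintegral_lt_top.ne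
  have h2 : ∫⁻ x, ENNReal.ofReal (-f x) ∂μ ≠ ∞ := hf.neg.lintegral_lt_top.ne
  rw [expectation, integral_eq_lintegral_pos_part_sub_lintegral_neg_part hf, EReal.coe_sub,
    EReal.coe_ennreal_toReal h1, EReal.coe_ennreal_toReal h2]

lemma coe_sum_ereal {ι : Type*} (s : Finset ι) (f : ι → ℝ) :
    ((∑ i ∈ s, f i : ℝ) : EReal) = ∑ i ∈ s, (f i : EReal) := by
  classical
  induction s using Finset.induction_on with
  | empty => simp
  | insert a s ha ih => rw [Finset.sum_insert ha, Finset.sum_insert ha, EReal.coe_add, ih]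

/-- Monotone convergence for the sum of finitely many expectations. -/
lemma sum_expectation_le_of_tendsto {ι : Type*} [Fintype ι] {S : ι → Type*}
    [∀ i, MeasurableSpace (S i)] (μ : ∀ i, Measure (S i)) [∀ i, IsProbabilityMeasure (μ i)]
    {c : ∀ i, S i → ℝ} {f : ∀ i, ℕ → S i → ℝ} (hint : ∀ i n, Integrable (f i n) (μ i))
    (hmono : ∀ i x, Monotone fun n => f i n x)
    (hlim : ∀ i x, Tendsto (fun n => f i n x) atTop (𝓝 (c i x))) {α : ℝ}
    (h : ∀ n, ∑ i, ∫ x, f i n x ∂(μ i) ≤ α) :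
    ∑ i, expectation (μ i) (c i) ≤ α := by
  classical
  have hImono : ∀ i, Monotone fun n => ∫ x, f i n x ∂(μ i) := fun i m n hmn =>
    integral_mono (hint i m) (hint i n) fun x => hmono i x hmn
  -- Only the sum is bounded above; each term inherits a uniform bound because the others are at
  -- least their values at `n = 0`.
  have hI : ∀ i n, ∫ x, f i n x ∂(μ i) ≤
      α - ∑ j ∈ Finset.univ.erase i, ∫ x, f j 0 x ∂(μ j) := fun i n => by
    have h1 := h n
    rw [← Finset.add_sum_erase _ _ (Finset.mem_univ i)] at h1
    have : ∑ j ∈ Finset.univ.erase i, ∫ x, f j 0 x ∂(μ j) ≤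
        ∑ j ∈ Finset.univ.erase i, ∫ x, f j n x ∂(μ j) :=
      Finset.sum_le_sum fun j _ => hImono j (Nat.zero_le n)
    linarith
  have hc : ∀ i, Integrable (c i) (μ i) := fun i => by
    have hd : ∀ n, Integrable (fun x => f i n x - f i 0 x) (μ i) :=
      fun n => (hint i n).sub (hint i 0)
    -- Fatou's lemma for the nonnegative increments `f i n - f i 0`, whose integrals are uniformly
    -- bounded by `hI`.
    have h1 : Integrable (fun x => c i x - f i 0 x) (μ i) := by
      have hl : ∀ᵐ x ∂(μ i), Tendsto (fun n => f i n x - f i 0 x) atTop (𝓝 (c i x - f i 0 x)) :=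
        Eventually.of_forall fun x => (hlim i x).sub_const _
      refine ⟨aestronglyMeasurable_of_tendsto_ae _ (fun n => (hd n).aestronglyMeasurable) hl, ?_⟩
      refine (lintegral_congr_ae (hl.mono fun x hx => hx.enorm.liminf_eq.symm)).trans_lt ?_
      refine (lintegral_liminf_le' fun n => (hd n).aestronglyMeasurable.enorm).trans_lt ?_
      refine lt_of_le_of_lt (liminf_le_of_frequently_le' (Frequently.of_forall fun n => ?_))
        (ENNReal.ofReal_lt_top (r :=
          α - ∑ j ∈ Finset.univ.erase i, ∫ x, f j 0 x ∂(μ j) - ∫ x, f i 0 x ∂(μ i)))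
      have hnn : ∀ x, 0 ≤ f i n x - f i 0 x := fun x => sub_nonneg.2 (hmono i x (Nat.zero_le n))
      simp only [Real.enorm_of_nonneg (hnn _)]
      rw [← ofReal_integral_eq_lintegral_ofReal (hd n) (Eventually.of_forall hnn),
        integral_sub (hint i n) (hint i 0)]
      exact ENNReal.ofReal_le_ofReal (sub_le_sub_right (hI i n) _)
    exact (h1.add (hint i 0)).congr (Eventually.of_forall fun x => sub_add_cancel _ _)
  have hlimI : ∀ i, Tendsto (fun n => ∫ x, f i n x ∂(μ i)) atTop (𝓝 (∫ x, c i x ∂(μ i))) :=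
    fun i => integral_tendsto_of_tendsto_of_monotone (hint i) (hc i)
      (Eventually.of_forall (hmono i)) (Eventually.of_forall (hlim i))
  have := le_of_tendsto' (tendsto_finsetSum Finset.univ fun i _ => hlimI i) h
  simp only [fun i => expectation_eq_integral (hc i), ← coe_sum_ereal]
  exact_mod_cast this

/-! ### Topology of the information spaces -/

section InfoTopology

instance (E : Type w) [TopologicalSpace E] [CompactSpace E] [MetrizableSpace E] :
    CompactSpace (BorelLaw E) := by
  let : MeasurableSpace E := borel E
  have : BorelSpace E := ⟨rfl⟩
  exact inferInstanceAs (CompactSpace (ProbabilityMeasure E))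

instance (E : Type w) [TopologicalSpace E] [CompactSpace E] [MetrizableSpace E] :
    MetrizableSpace (BorelLaw E) := by
  let : MeasurableSpace E := borel E
  have : BorelSpace E := ⟨rfl⟩
  let := metrizableSpaceMetric E
  exact inferInstanceAs (MetrizableSpace (ProbabilityMeasure E))

instance (E : Type w) [TopologicalSpace E] [Nonempty E] : Nonempty (BorelLaw E) := by
  let : MeasurableSpace E := borel E
  exact ⟨diracProba (Classical.arbitrary E)⟩

variable {T : ℕ} {𝒴 : Fin T → Type w} [∀ t, TopologicalSpace (𝒴 t)]

/-- The properties are carried together in the recursion, since compactness and metrizability of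
`BorelLaw E` each use both for `E`. -/
lemma infoSpace_properties [∀ t, CompactSpace (𝒴 t)] [∀ t, MetrizableSpace (𝒴 t)]
    [∀ t, Nonempty (𝒴 t)] : ∀ (k t : ℕ) (h : t + k < T),
    CompactSpace (infoSpace 𝒴 k t h) ∧ MetrizableSpace (infoSpace 𝒴 k t h) ∧
      Nonempty (infoSpace 𝒴 k t h)
  | 0, t, h => ⟨inferInstanceAs (CompactSpace (𝒴 _)), inferInstanceAs (MetrizableSpace (𝒴 _)),
      inferInstanceAs (Nonempty (𝒴 _))⟩
  | k + 1, t, h => by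
      obtain ⟨h1, h2, h3⟩ := infoSpace_properties k (t + 1) (by omega)
      exact ⟨inferInstanceAs (CompactSpace (𝒴 _ × BorelLaw _)),
        inferInstanceAs (MetrizableSpace (𝒴 _ × BorelLaw _)),
        inferInstanceAs (Nonempty (𝒴 _ × BorelLaw _))⟩

lemma continuous_infoSpace_state : ∀ (k t : ℕ) (h : t + k < T),
    Continuous (infoSpace.state (𝒴 := 𝒴) k t h)
  | 0, _, _ => continuous_id
  | _ + 1, _, _ => continuous_fst

lemma continuous_infoSpace_next : ∀ (k t : ℕ) (h : t + k < T) (hk : 0 < k),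
    Continuous (infoSpace.next (𝒴 := 𝒴) k t h hk)
  | _ + 1, _, _, _ => continuous_snd

/-- The point of an information space with given components, before the last date. -/
def infoSpace.mk : (k t : ℕ) → (h : t + k < T) → (hk : 0 < k) →
    𝒴 ⟨t, by omega⟩ × BorelLaw (infoSpace 𝒴 (k - 1) (t + 1) (by omega)) → infoSpace 𝒴 k t h
  | _ + 1, _, _, _, z => z

/-- The point of the information space at the last date with given state. -/
def infoSpace.mkLast : (k t : ℕ) → (h : t + k < T) → (hk : k = 0) →
    𝒴 ⟨t, by omega⟩ → infoSpace 𝒴 k t h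
  | 0, _, _, _, z => z

lemma continuous_infoSpace_mk : ∀ (k t : ℕ) (h : t + k < T) (hk : 0 < k),
    Continuous (infoSpace.mk (𝒴 := 𝒴) k t h hk)
  | _ + 1, _, _, _ => continuous_id

lemma continuous_infoSpace_mkLast : ∀ (k t : ℕ) (h : t + k < T) (hk : k = 0),
    Continuous (infoSpace.mkLast (𝒴 := 𝒴) k t h hk)
  | 0, _, _, _ => continuous_id

lemma infoSpace_state_mk : ∀ (k t : ℕ) (h : t + k < T) (hk : 0 < k) (z),
    infoSpace.state (𝒴 := 𝒴) k t h (infoSpace.mk k t h hk z) = z.1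
  | _ + 1, _, _, _, _ => rfl

lemma infoSpace_next_mk : ∀ (k t : ℕ) (h : t + k < T) (hk : 0 < k) (z),
    infoSpace.next (𝒴 := 𝒴) k t h hk (infoSpace.mk k t h hk z) = z.2
  | _ + 1, _, _, _, _ => rfl

lemma infoSpace_state_mkLast : ∀ (k t : ℕ) (h : t + k < T) (hk : k = 0) (z),
    infoSpace.state (𝒴 := 𝒴) k t h (infoSpace.mkLast k t h hk z) = z
  | 0, _, _, _, _ => rfl

instance [∀ t, CompactSpace (𝒴 t)] [∀ t, MetrizableSpace (𝒴 t)] [∀ t, Nonempty (𝒴 t)]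
    (t : Fin T) : CompactSpace (Info 𝒴 t) := (infoSpace_properties _ _ _).1

instance [∀ t, CompactSpace (𝒴 t)] [∀ t, MetrizableSpace (𝒴 t)] [∀ t, Nonempty (𝒴 t)]
    (t : Fin T) : MetrizableSpace (Info 𝒴 t) := (infoSpace_properties _ _ _).2.1

instance [∀ t, CompactSpace (𝒴 t)] [∀ t, MetrizableSpace (𝒴 t)] [∀ t, Nonempty (𝒴 t)]
    (t : Fin T) : Nonempty (Info 𝒴 t) := (infoSpace_properties _ _ _).2.2

instance [∀ t, CompactSpace (𝒴 t)] [∀ t, MetrizableSpace (𝒴 t)] [∀ t, Nonempty (𝒴 t)]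
    (t : Fin T) : PolishSpace (Info 𝒴 t) := by
  let := metrizableSpaceMetric (Info 𝒴 t)
  infer_instance

lemma Info.continuous_state (t : Fin T) : Continuous (Info.state (𝒴 := 𝒴) (t := t)) :=
  continuous_infoSpace_state _ _ _

lemma Info.continuous_next {t : ℕ} (h : t + 1 < T) :
    Continuous (Info.next (𝒴 := 𝒴) h) :=
  continuous_infoSpace_next _ _ _ _

/-- The point of `𝒵_t` with given components, before the last date. -/
def Info.mk {t : ℕ} (h : t + 1 < T) (y : 𝒴 ⟨t, by omega⟩)
    (p : ProbabilityMeasure (Info 𝒴 ⟨t + 1, h⟩)) : Info 𝒴 ⟨t, by omega⟩ :=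
  infoSpace.mk (T - 1 - t) t (by omega) (by omega) (y, p)

/-- The point of `𝒵_T` with given state. -/
def Info.mkLast {t : Fin T} (h : ¬ t.val + 1 < T) (y : 𝒴 t) : Info 𝒴 t :=
  infoSpace.mkLast (T - 1 - t) t (by omega) (by omega) y

lemma Info.continuous_mk {t : ℕ} (h : t + 1 < T) :
    Continuous fun z : 𝒴 ⟨t, by omega⟩ × ProbabilityMeasure (Info 𝒴 ⟨t + 1, h⟩) =>
      Info.mk h z.1 z.2 :=
  continuous_infoSpace_mk _ _ _ _

lemma Info.continuous_mkLast {t : Fin T} (h : ¬ t.val + 1 < T) :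
    Continuous (Info.mkLast (𝒴 := 𝒴) h) :=
  continuous_infoSpace_mkLast _ _ _ _

@[simp] lemma Info.state_mk {t : ℕ} (h : t + 1 < T) (y : 𝒴 ⟨t, by omega⟩)
    (p : ProbabilityMeasure (Info 𝒴 ⟨t + 1, h⟩)) : (Info.mk h y p).state = y :=
  infoSpace_state_mk _ _ _ _ _

@[simp] lemma Info.next_mk {t : ℕ} (h : t + 1 < T) (y : 𝒴 ⟨t, by omega⟩)
    (p : ProbabilityMeasure (Info 𝒴 ⟨t + 1, h⟩)) : (Info.mk h y p).next h = p :=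
  infoSpace_next_mk _ _ _ _ _

@[simp] lemma Info.state_mkLast {t : Fin T} (h : ¬ t.val + 1 < T) (y : 𝒴 t) :
    (Info.mkLast h y).state = y :=
  infoSpace_state_mkLast _ _ _ _ _

lemma continuous_infoState : Continuous (infoState (𝒴 := 𝒴)) :=
  continuous_pi fun t => (Info.continuous_state t).comp (continuous_apply t)

lemma continuous_infoKernel : ∀ (t : Fin T) (h : 0 < t.val),
    Continuous (infoKernel (𝒴 := 𝒴) t h)
  | ⟨0, _⟩, h => absurd h (lt_irrefl 0)
  | ⟨_ + 1, ht⟩, _ => (Info.continuous_next ht).comp (continuous_apply _)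

end InfoTopology

/-! ### Paths and pasts -/

section Paths

variable {T : ℕ} {E : Fin T → Type u}

/-- The path with past `h` before `t`, value `e` at `t`, and values of `b` after `t`. -/
def splice (b : Path E) (t : Fin T) (h : Past E t) (e : E t) : Path E :=
  Function.update (fun s => if hs : s < t then h ⟨s, hs⟩ else b s) t e

lemma splice_of_lt (b : Path E) {t s : Fin T} (h : Past E t) (e : E t) (hs : s < t) :
    splice b t h e s = h ⟨s, hs⟩ := by
  rw [splice, Function.update_of_ne hs.ne, dif_pos hs]

@[simp] lemma splice_self (b : Path E) (t : Fin T) (h : Past E t) (e : E t) :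
    splice b t h e t = e := by
  simp [splice]

@[simp] lemma past_splice (b : Path E) (t : Fin T) (h : Past E t) (e : E t) :
    past t (splice b t h e) = h := by
  funext s
  exact splice_of_lt b h e s.2

lemma past_eq_iff {t : Fin T} {x y : Path E} : past t x = past t y ↔ ∀ s < t, x s = y s :=
  ⟨fun h s hs => congrFun h ⟨s, hs⟩, fun h => funext fun s => h s s.2⟩

section Topology

variable [∀ t, TopologicalSpace (E t)]

@[fun_prop] lemma continuous_past (t : Fin T) : Continuous (past (E := E) t) :=
  continuous_pi fun _ => continuous_apply _

lemma continuous_splice (b : Path E) (t : Fin T) :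
    Continuous fun p : Past E t × E t => splice b t p.1 p.2 := by
  refine Continuous.update (continuous_pi fun s => ?_) t continuous_snd
  split_ifs
  · exact (continuous_apply _).comp continuous_fst
  · exact continuous_const

end Topology

section Measurable

variable [∀ t, MeasurableSpace (E t)]

@[fun_prop] lemma measurable_past (t : Fin T) : Measurable (past (E := E) t) :=
  measurable_pi_lambda _ fun _ => measurable_pi_apply _

lemma measurable_splice (b : Path E) (t : Fin T) :
    Measurable fun p : Past E t × E t => splice b t p.1 p.2 := by
  refine measurable_pi_lambda _ fun s => ?_
  rcases eq_or_ne s t with rfl | hst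
  · simpa using measurable_snd
  simp only [splice, Function.update_of_ne hst]
  split_ifs
  · exact (measurable_pi_apply _).comp measurable_fst
  · exact measurable_const

end Measurable

end Paths

/-! ### Conditional independence -/

section CondIndep

variable {S : Type*} {m' m₁ m₂ : MeasurableSpace S} {mS : MeasurableSpace S}
  {μ : Measure S}

lemma setIntegral_mul_indicator_one {u : S → ℝ} {s t : Set S} (ht : MeasurableSet t) :
    ∫ x in s, (u * t.indicator fun _ => (1 : ℝ)) x ∂μ = ∫ x in s ∩ t, u x ∂μ := by
  have : u * (t.indicator fun _ => (1 : ℝ)) = t.indicator u := by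
    ext x
    by_cases hx : x ∈ t <;> simp [hx]
  rw [this, setIntegral_indicator ht]

variable [IsFiniteMeasure μ]

lemma setIntegral_indicator_one {s t : Set S} (ht : MeasurableSet t) :
    ∫ x in s, t.indicator (fun _ => (1 : ℝ)) x ∂μ = μ.real (t ∩ s) := by
  rw [integral_indicator ht, setIntegral_const, smul_eq_mul, mul_one, measureReal_def,
    Measure.restrict_apply ht, measureReal_def]

lemma integrable_indicator_one {t : Set S} (ht : MeasurableSet t) :
    Integrable (t.indicator fun _ => (1 : ℝ)) μ :=
  (integrable_const _).indicator ht

lemma integrable_of_bound_one (hm' : m' ≤ mS) {u : S → ℝ} (hu : Measurable[m'] u)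
    (hb : ∀ x, ‖u x‖ ≤ 1) : Integrable u μ :=
  Integrable.of_bound (hu.mono hm' le_rfl).aestronglyMeasurable 1 (Eventually.of_forall hb)

lemma integrable_mul_indicator_one (hm' : m' ≤ mS) {u : S → ℝ} (hu : Measurable[m'] u)
    (hb : ∀ x, ‖u x‖ ≤ 1) {t : Set S} (ht : MeasurableSet t) :
    Integrable (u * t.indicator fun _ => (1 : ℝ)) μ := by
  have : u * (t.indicator fun _ => (1 : ℝ)) = t.indicator u := by
    ext x
    by_cases hx : x ∈ t <;> simp [hx]
  rw [this]
  exact (integrable_of_bound_one hm' hu hb).indicator ht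

variable [StandardBorelSpace S]

/-- Taking `t₂ = univ` shows that `u` is a version of the conditional probability of `t₁` given
`m'`. For general `t₂` the identity identifies the conditional probability of `t₁ ∩ t₂` with that of
`u` times the indicator of `t₂`, and `u` factors out. -/
lemma condIndep_of_forall_setIntegral_eq (hm' : m' ≤ mS) (hm₁ : m₁ ≤ mS) (hm₂ : m₂ ≤ mS)
    (h : ∀ t₁, MeasurableSet[m₁] t₁ → ∃ u : S → ℝ, Measurable[m'] u ∧ (∀ x, ‖u x‖ ≤ 1) ∧
      ∀ s, MeasurableSet[m'] s → ∀ t₂, MeasurableSet[m₂] t₂ →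
        μ.real (t₁ ∩ (s ∩ t₂)) = ∫ x in s ∩ t₂, u x ∂μ) :
    CondIndep m' m₁ m₂ hm' μ := by
  rw [condIndep_iff m' m₁ m₂ hm' hm₁ hm₂]
  intro t₁ t₂ ht₁ ht₂
  obtain ⟨u, hu, hub, hut⟩ := h t₁ ht₁
  have hui := integrable_of_bound_one (μ := μ) hm' hu hub
  have h1 : u =ᵐ[μ] μ[t₁.indicator fun _ => (1 : ℝ) | m'] := by
    refine ae_eq_condExp_of_forall_setIntegral_eq hm' (integrable_indicator_one (hm₁ _ ht₁))
      (fun s _ _ => hui.integrableOn) (fun s hs _ => ?_)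
      hu.stronglyMeasurable.aestronglyMeasurable
    rw [setIntegral_indicator_one (hm₁ _ ht₁)]
    simpa using (hut s hs univ MeasurableSet.univ).symm
  have h2 := condExp_mul_of_stronglyMeasurable_left (μ := μ) hu.stronglyMeasurable
    (integrable_mul_indicator_one hm' hu hub (hm₂ _ ht₂)) (integrable_indicator_one (hm₂ _ ht₂))
  have h3 : μ[u * t₂.indicator fun _ => (1 : ℝ) | m'] =ᵐ[μ]
      μ[(t₁ ∩ t₂).indicator fun _ => (1 : ℝ) | m'] := by
    refine ae_eq_condExp_of_forall_setIntegral_eq hm'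
      (integrable_indicator_one ((hm₁ _ ht₁).inter (hm₂ _ ht₂)))
      (fun s _ _ => integrable_condExp.integrableOn) (fun s hs _ => ?_)
      stronglyMeasurable_condExp.aestronglyMeasurable
    rw [setIntegral_condExp hm' (integrable_mul_indicator_one hm' hu hub (hm₂ _ ht₂)) hs,
      setIntegral_mul_indicator_one (hm₂ _ ht₂),
      setIntegral_indicator_one ((hm₁ _ ht₁).inter (hm₂ _ ht₂)), ← hut s hs t₂ ht₂,
      inter_comm s t₂, inter_assoc]
  filter_upwards [h1, h2, h3] with x h1 h2 h3
  rw [← h3, h2, Pi.mul_apply, Pi.mul_apply, h1]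

/-- Converse direction: conditional independence upgrades an explicit version `u` of the conditional
probability given `m'` to one that is also valid on sets `s ∩ t₂`. -/
lemma measureReal_inter_eq_setIntegral_of_condIndep (hm' : m' ≤ mS) (hm₁ : m₁ ≤ mS)
    (hm₂ : m₂ ≤ mS) (h : CondIndep m' m₁ m₂ hm' μ) {t₁ : Set S} (ht₁ : MeasurableSet[m₁] t₁)
    {u : S → ℝ} (hu : Measurable[m'] u) (hub : ∀ x, ‖u x‖ ≤ 1)
    (hut : ∀ s, MeasurableSet[m'] s → μ.real (t₁ ∩ s) = ∫ x in s, u x ∂μ) {s : Set S}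
    (hs : MeasurableSet[m'] s) {t₂ : Set S} (ht₂ : MeasurableSet[m₂] t₂) :
    μ.real (t₁ ∩ (s ∩ t₂)) = ∫ x in s ∩ t₂, u x ∂μ := by
  have hui := integrable_of_bound_one (μ := μ) hm' hu hub
  have h1 : u =ᵐ[μ] μ[t₁.indicator fun _ => (1 : ℝ) | m'] := by
    refine ae_eq_condExp_of_forall_setIntegral_eq hm' (integrable_indicator_one (hm₁ _ ht₁))
      (fun s _ _ => hui.integrableOn) (fun s hs _ => ?_)
      hu.stronglyMeasurable.aestronglyMeasurable
    rw [setIntegral_indicator_one (hm₁ _ ht₁), hut s hs]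
  have h2 := condExp_mul_of_stronglyMeasurable_left (μ := μ) hu.stronglyMeasurable
    (integrable_mul_indicator_one hm' hu hub (hm₂ _ ht₂)) (integrable_indicator_one (hm₂ _ ht₂))
  have h3 := (condIndep_iff m' m₁ m₂ hm' hm₁ hm₂ μ).1 h t₁ t₂ ht₁ ht₂
  have h4 : μ[(t₁ ∩ t₂).indicator fun _ => (1 : ℝ) | m'] =ᵐ[μ]
      μ[u * t₂.indicator fun _ => (1 : ℝ) | m'] := by
    filter_upwards [h1, h2, h3] with x h1 h2 h3
    rw [h2, h3, Pi.mul_apply, Pi.mul_apply, h1]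
  calc μ.real (t₁ ∩ (s ∩ t₂))
      = ∫ x in s, (t₁ ∩ t₂).indicator (fun _ => (1 : ℝ)) x ∂μ := by
        rw [setIntegral_indicator_one ((hm₁ _ ht₁).inter (hm₂ _ ht₂)), inter_comm s t₂,
          inter_assoc]
    _ = ∫ x in s, (μ[(t₁ ∩ t₂).indicator fun _ => (1 : ℝ) | m']) x ∂μ :=
        (setIntegral_condExp hm'
          (integrable_indicator_one ((hm₁ _ ht₁).inter (hm₂ _ ht₂))) hs).symm
    _ = ∫ x in s, (μ[u * t₂.indicator fun _ => (1 : ℝ) | m']) x ∂μ :=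
        setIntegral_congr_ae (hm' _ hs) (h4.mono fun x hx _ => hx)
    _ = ∫ x in s ∩ t₂, u x ∂μ := by
        rw [setIntegral_condExp hm' (integrable_mul_indicator_one hm' hu hub (hm₂ _ ht₂)) hs,
          setIntegral_mul_indicator_one (hm₂ _ ht₂)]

end CondIndep

/-! ### Disintegration along kernels -/

section Disintegration

variable {T : ℕ} {A : Fin T → Type u} [∀ t, MeasurableSpace (A t)]

/-- At date `t`, the conditional law of the coordinate given the past is the kernel `κ t`. -/
def DisintegratesAt (κ : ∀ t, Kernel (Past A t) (A t)) (μ : Measure (Path A)) (t : Fin T) : Prop :=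
  μ.map (fun x => (past t x, x t)) = (μ.map (past t)) ⊗ₘ (κ t)

@[fun_prop] lemma measurable_past_prodMk_apply (t : Fin T) :
    Measurable fun x : Path A => (past t x, x t) :=
  (measurable_past t).prodMk (measurable_pi_apply t)

lemma DisintegratesAt.lintegral_eq {κ : ∀ t, Kernel (Past A t) (A t)} [∀ t, IsMarkovKernel (κ t)]
    {μ : Measure (Path A)} [IsFiniteMeasure μ] {t : Fin T} (h : DisintegratesAt κ μ t)
    {f : Past A t × A t → ℝ≥0∞} (hf : Measurable f) :
    ∫⁻ x, f (past t x, x t) ∂μ = ∫⁻ x, ∫⁻ e, f (past t x, e) ∂(κ t (past t x)) ∂μ := by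
  rw [← lintegral_map hf (measurable_past_prodMk_apply t), h, Measure.lintegral_compProd hf,
    lintegral_map hf.lintegral_kernel_prod_right' (measurable_past t)]

/-- Backward integration: an integral over paths reduces to the integral of a function of the
coordinates before a given date. -/
lemma exists_backward_integral (κ : ∀ t, Kernel (Past A t) (A t)) [∀ t, IsMarkovKernel (κ t)]
    (b : Path A) {f : Path A → ℝ≥0∞} (hf : Measurable f) (hf1 : ∀ x, f x ≤ 1) {s : ℕ}
    (hs : s ≤ T) : ∃ F : Path A → ℝ≥0∞, Measurable F ∧ (∀ x, F x ≤ 1) ∧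
      DependsOn F {r | r.val < s} ∧ ∀ μ : Measure (Path A), IsFiniteMeasure μ →
        (∀ r : Fin T, s ≤ r.val → DisintegratesAt κ μ r) → ∫⁻ x, f x ∂μ = ∫⁻ x, F x ∂μ := by
  induction hs using Nat.decreasingInduction with
  | self => exact ⟨f, hf, hf1, fun x y h => congrArg f (funext fun r => h r r.2), fun _ _ _ => rfl⟩
  | of_succ s hs ih =>
    obtain ⟨F, hF, hF1, hFd, hFint⟩ := ih
    -- The coordinate at date `s` is integrated out. The values of `b` filled in after that date are
    -- irrelevant because `F` depends only on coordinates up to `s`.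
    let r : Fin T := ⟨s, hs⟩
    have hφ : Measurable fun p : Past A r × A r => F (splice b r p.1 p.2) :=
      hF.comp (measurable_splice b r)
    refine ⟨fun x => ∫⁻ e, F (splice b r (past r x) e) ∂(κ r (past r x)),
      hφ.lintegral_kernel_prod_right'.comp (measurable_past r), fun x => ?_, fun x y h => ?_,
      fun μ _ hμ => ?_⟩
    · calc _ ≤ ∫⁻ e, 1 ∂(κ r (past r x)) := lintegral_mono fun e => hF1 _
        _ = 1 := by simp
    · have : past r x = past r y := past_eq_iff.2 fun q hq => h q hq
      simp only [this]
    · rw [hFint μ inferInstance fun q hq => hμ q ((Nat.le_succ s).trans hq),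
        ← (hμ r le_rfl).lintegral_eq hφ]
      refine lintegral_congr fun x => hFd fun q hq => ?_
      rcases (Nat.lt_succ_iff.1 hq).lt_or_eq with h | h
      · exact (splice_of_lt b (past r x) (x r) (show q < r from h)).symm
      · obtain rfl : q = r := Fin.ext h
        simp

/-- The law of a path is determined by its successive disintegration kernels. -/
lemma eq_of_disintegratesAt {κ : ∀ t, Kernel (Past A t) (A t)} [∀ t, IsMarkovKernel (κ t)]
    {μ ν : Measure (Path A)} [IsProbabilityMeasure μ] [IsProbabilityMeasure ν]
    (hμ : ∀ t, DisintegratesAt κ μ t) (hν : ∀ t, DisintegratesAt κ ν t) : μ = ν := by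
  classical
  obtain ⟨b⟩ := μ.nonempty_of_neZero
  ext s hs
  obtain ⟨F, -, -, hFd, hF⟩ := exists_backward_integral κ b
    (f := s.indicator 1) (measurable_one.indicator hs)
    (fun x => indicator_le_self' (fun _ _ => zero_le) x) (Nat.zero_le T)
  -- With every date integrated out, `F` is a constant determined by the kernels alone, hence the
  -- same for both measures.
  have hc : ∀ x, F x = F b := fun x => hFd (by simp)
  have h1 := hF μ inferInstance fun r _ => hμ r
  have h2 := hF ν inferInstance fun r _ => hν r
  simp only [hc, lintegral_const, measure_univ, lintegral_indicator_one hs] at h1 h2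
  rw [h1, h2]

end Disintegration

/-! ### Causality in terms of kernels -/

section Causality

variable {T : ℕ} {A : Fin T → Type u} {B : Fin T → Type w}

lemma measurable_past_piLE [∀ t, MeasurableSpace (A t)] {s t : Fin T}
    (h : ∀ r < t, r ≤ s) : Measurable[Filtration.piLE (X := A) s] (past (E := A) t) := by
  have : Measurable fun (x : ∀ r : Iic s, A r) (r : Iio t) => x ⟨r, h r r.2⟩ :=
    measurable_pi_lambda _ fun r => measurable_pi_apply _
  exact this.comp (comap_measurable (Preorder.restrictLe s))

/-- `F` factors through the restriction to dates up to `t`, the later coordinates being frozen at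
`b`. -/
lemma measurable_piLE_of_dependsOn [∀ t, MeasurableSpace (A t)] {β : Type*} [MeasurableSpace β]
    (b : Path A) {t : Fin T} {F : Path A → β} (hF : Measurable F) (hd : DependsOn F (Iic t)) :
    Measurable[Filtration.piLE (X := A) t] F := by
  classical
  let ext : (∀ s : Iic t, A s) → Path A := fun h s => if hs : s ≤ t then h ⟨s, hs⟩ else b s
  have hext : Measurable ext := by
    refine measurable_pi_lambda _ fun s => ?_
    simp only [ext]
    split_ifs with hs
    · exact measurable_pi_apply _
    · exact measurable_const
  have : F = (F ∘ ext) ∘ Preorder.restrictLe t := by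
    funext x
    refine hd fun s hs => ?_
    simp [ext, Preorder.restrictLe, show s ≤ t from hs]
  rw [this]
  exact (hF.comp hext).comp (comap_measurable _)

lemma dependsOn_of_measurable_piLE [∀ t, MeasurableSpace (A t)] {β : Type*} [MeasurableSpace β]
    [MeasurableSingletonClass β] {t : Fin T} {F : Path A → β}
    (hF : Measurable[Filtration.piLE (X := A) t] F) : DependsOn F (Iic t) := by
  intro x y h
  obtain ⟨s, -, hs⟩ := hF (measurableSet_singleton (F x))
  have hxy : Preorder.restrictLe (π := A) t x = Preorder.restrictLe t y :=
    funext fun r => h r r.2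
  have h1 : x ∈ F ⁻¹' {F x} := rfl
  rw [← hs, mem_preimage, hxy, ← mem_preimage, hs] at h1
  exact h1.symm

lemma mem_iff_of_measurableSet_piLE [∀ t, MeasurableSpace (A t)] {t : Fin T} {s : Set (Path A)}
    (hs : MeasurableSet[Filtration.piLE (X := A) t] s) {x y : Path A} (h : ∀ r ≤ t, x r = y r) :
    x ∈ s ↔ y ∈ s := by
  obtain ⟨s', -, rfl⟩ := hs
  have hxy : Preorder.restrictLe (π := A) t x = Preorder.restrictLe t y :=
    funext fun r => h r r.2
  rw [mem_preimage, mem_preimage, hxy]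

lemma subsingleton_past {t : Fin T} (ht : t.val = 0) : Subsingleton (Past A t) :=
  ⟨fun _ _ => funext fun r => absurd (Fin.lt_def.1 r.2) (by omega)⟩

variable [∀ t, MeasurableSpace (A t)] [∀ t, MeasurableSpace (B t)]

/-- Under `π`, at date `t`, the conditional law of the coordinate of the first path given the pasts
of both paths is the kernel `κ t` at the past of the first path. -/
def NonanticipativeAt (κ : ∀ t, Kernel (Past A t) (A t)) (π : Measure (Path A × Path B))
    (t : Fin T) : Prop :=
  π.map (fun p => ((past t p.1, past t p.2), p.1 t)) =
    (π.map fun p => (past t p.1, past t p.2)) ⊗ₘ ((κ t).comap Prod.fst measurable_fst)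

@[fun_prop] lemma measurable_pasts (t : Fin T) :
    Measurable fun p : Path A × Path B => (past t p.1, past t p.2) :=
  ((measurable_past t).comp measurable_fst).prodMk ((measurable_past t).comp measurable_snd)

@[fun_prop] lemma measurable_pasts_prodMk (t : Fin T) :
    Measurable fun p : Path A × Path B => ((past t p.1, past t p.2), p.1 t) :=
  (measurable_pasts t).prodMk ((measurable_pi_apply t).comp measurable_fst)

variable {κ : ∀ t, Kernel (Past A t) (A t)} [∀ t, IsMarkovKernel (κ t)]

lemma nonanticipativeAt_of_forall {π : Measure (Path A × Path B)} [IsFiniteMeasure π] {t : Fin T}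
    (h : ∀ s : Set (Past A t), MeasurableSet s → ∀ s' : Set (Past B t), MeasurableSet s' →
      ∀ d : Set (A t), MeasurableSet d →
      π {p | (past t p.1 ∈ s ∧ past t p.2 ∈ s') ∧ p.1 t ∈ d} =
        ∫⁻ p in {p | past t p.1 ∈ s ∧ past t p.2 ∈ s'}, κ t (past t p.1) d ∂π) :
    NonanticipativeAt κ π t := by
  refine Measure.ext_prod₃_iff'.2 fun {s s' d} hs hs' hd => ?_
  have hss : MeasurableSet (s ×ˢ s') := hs.prod hs'
  rw [Measure.map_apply (by fun_prop) (hss.prod hd), Measure.compProd_apply_prod hss hd,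
    setLIntegral_map hss (Kernel.measurable_coe _ hd) (by fun_prop)]
  exact h s hs s' hs' d hd

lemma DisintegratesAt.measure_eq {μ : Measure (Path A)} [IsFiniteMeasure μ] {t : Fin T}
    (h : DisintegratesAt κ μ t) {s : Set (Past A t)} (hs : MeasurableSet s) {d : Set (A t)}
    (hd : MeasurableSet d) :
    μ {x | past t x ∈ s ∧ x t ∈ d} = ∫⁻ x in past t ⁻¹' s, κ t (past t x) d ∂μ := by
  have := congrArg (fun m => m (s ×ˢ d)) h
  rw [Measure.map_apply (by fun_prop) (hs.prod hd), Measure.compProd_apply_prod hs hd,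
    setLIntegral_map hs (Kernel.measurable_coe _ hd) (measurable_past t)] at this
  exact this

lemma DisintegratesAt.measure_fst_eq {π : Measure (Path A × Path B)} [IsFiniteMeasure π]
    {t : Fin T} (h : DisintegratesAt κ (π.map Prod.fst) t) {s : Set (Past A t)}
    (hs : MeasurableSet s) {d : Set (A t)} (hd : MeasurableSet d) :
    π {p | past t p.1 ∈ s ∧ p.1 t ∈ d} =
      ∫⁻ p in {p | past t p.1 ∈ s}, κ t (past t p.1) d ∂π := by
  have hm : Measurable fun x : Path A => κ t (past t x) d :=
    (Kernel.measurable_coe _ hd).comp (measurable_past t)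
  have hsd : MeasurableSet {x : Path A | past t x ∈ s ∧ x t ∈ d} :=
    (measurable_past_prodMk_apply t) (hs.prod hd)
  have := h.measure_eq hs hd
  rwa [Measure.map_apply measurable_fst hsd,
    setLIntegral_map ((measurable_past t) hs) hm measurable_fst] at this

/-- At the first date the other past is a one-point space, so conditioning on it adds nothing. -/
lemma nonanticipativeAt_of_val_eq_zero {π : Measure (Path A × Path B)} [IsFiniteMeasure π]
    {t : Fin T} (ht : t.val = 0) (h : DisintegratesAt κ (π.map Prod.fst) t) :
    NonanticipativeAt κ π t := by
  have := subsingleton_past (A := B) ht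
  refine nonanticipativeAt_of_forall fun s hs s' _ d hd => ?_
  refine Subsingleton.set_cases (p := fun s' : Set (Past B t) =>
    π {p | (past t p.1 ∈ s ∧ past t p.2 ∈ s') ∧ p.1 t ∈ d} =
        ∫⁻ p in {p | past t p.1 ∈ s ∧ past t p.2 ∈ s'}, κ t (past t p.1) d ∂π) ?_ ?_ s'
  · simp
  · simpa using h.measure_fst_eq hs hd

lemma measurableSet_comap_piLE_iff_past [Nonempty (Path A)] {s t : Fin T} (h : s < t)
    {D : Set (Path A × Path B)}
    (hD : MeasurableSet[(Filtration.piLE (X := A) s).comap Prod.fst] D) :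
    ∃ d : Set (Past A t), MeasurableSet d ∧ D = {p | past t p.1 ∈ d} := by
  obtain ⟨b⟩ := ‹Nonempty (Path A)›
  obtain ⟨D', hD', rfl⟩ := hD
  refine ⟨{g | splice b t g (b t) ∈ D'}, ?_, ?_⟩
  · exact (measurable_splice b t).comp (measurable_id.prodMk measurable_const)
      (Filtration.piLE.le s _ hD')
  · ext p
    exact mem_iff_of_measurableSet_piLE hD' fun r hr =>
      (splice_of_lt b (past t p.1) (b t) (hr.trans_lt h)).symm

/-- An event `W` determined by the two pasts is the preimage of a set `U` of pairs of pasts, and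
conditioning on such an event does not change the conditional law at date `r`. -/
lemma NonanticipativeAt.disintegratesAt_restrict {π : Measure (Path A × Path B)}
    [IsFiniteMeasure π] {r : Fin T} (h : NonanticipativeAt κ π r) (b : Path A × Path B)
    {W : Set (Path A × Path B)} (hW : MeasurableSet W)
    (hWd : ∀ p q : Path A × Path B, (∀ s < r, p.1 s = q.1 s) → (∀ s < r, p.2 s = q.2 s) →
      (p ∈ W ↔ q ∈ W)) :
    DisintegratesAt κ ((π.restrict W).map Prod.fst) r := by
  let U : Set (Past A r × Past B r) :=
    {g | (splice b.1 r g.1 (b.1 r), splice b.2 r g.2 (b.2 r)) ∈ W}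
  have hU : MeasurableSet U :=
    (((measurable_splice b.1 r).comp (measurable_fst.prodMk measurable_const)).prodMk
      ((measurable_splice b.2 r).comp (measurable_snd.prodMk measurable_const))) hW
  have hWU : ∀ p : Path A × Path B, p ∈ W ↔ (past r p.1, past r p.2) ∈ U := fun p =>
    hWd _ _ (fun s hs => (splice_of_lt b.1 (past r p.1) (b.1 r) hs).symm)
      (fun s hs => (splice_of_lt b.2 (past r p.2) (b.2 r) hs).symm)
  refine Measure.ext_prod fun {s d} hs hd => ?_
  have hUs : MeasurableSet (U ∩ Prod.fst ⁻¹' s) := hU.inter (measurable_fst hs)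
  have key := congrArg (fun m => m ((U ∩ Prod.fst ⁻¹' s) ×ˢ d)) h
  rw [Measure.map_apply (by fun_prop) (hUs.prod hd), Measure.compProd_apply_prod hUs hd,
    setLIntegral_map hUs (Kernel.measurable_coe _ hd) (by fun_prop)] at key
  have hm : Measurable fun x : Past A r => κ r x d := Kernel.measurable_coe _ hd
  have hm' : Measurable fun x : Path A => κ r (past r x) d := hm.comp (measurable_past r)
  rw [Measure.map_apply (by fun_prop) (hs.prod hd), Measure.compProd_apply_prod hs hd,
    setLIntegral_map hs hm (by fun_prop), setLIntegral_map (measurable_past r hs) hm'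
      measurable_fst,
    Measure.map_apply measurable_fst ((measurable_past_prodMk_apply r) (hs.prod hd)),
    Measure.restrict_apply
      (measurable_fst ((measurable_past_prodMk_apply r) (hs.prod hd))),
    Measure.restrict_restrict (measurable_fst (measurable_past r hs))]
  convert key using 2
  · ext p
    simp only [mem_inter_iff, mem_preimage, mem_prod, hWU p]
    tauto
  · congr 1
    ext p
    simp only [mem_inter_iff, mem_preimage, hWU p]
    tauto
  · rfl

section StandardBorel

variable [∀ t, StandardBorelSpace (A t)] [∀ t, StandardBorelSpace (B t)]

/-- Causality at the preceding date says that, given its own past, the coordinate at `t` is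
independent of the other past, so its conditional law is the kernel of its own marginal. -/
lemma IsCausal.nonanticipativeAt {π : Measure (Path A × Path B)} [IsProbabilityMeasure π]
    (h : IsCausal π) {t : Fin T} (hd : DisintegratesAt κ (π.map Prod.fst) t) :
    NonanticipativeAt κ π t := by
  rcases Nat.eq_zero_or_pos t.val with h0 | h0
  · exact nonanticipativeAt_of_val_eq_zero h0 hd
  obtain ⟨⟨b, -⟩⟩ := π.nonempty_of_neZero
  have : Nonempty (Path A) := ⟨b⟩
  let s : Fin T := ⟨t.val - 1, by omega⟩
  have hst : s < t := Fin.lt_def.2 (Nat.sub_lt h0 one_pos)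
  have hts : ∀ r < t, r ≤ s := fun r hr => Fin.le_def.2 (Nat.le_sub_one_of_lt hr)
  refine nonanticipativeAt_of_forall fun a ha a' ha' d hd' => ?_
  let q : Path A × Path B → ℝ := fun p => (κ t (past t p.1)).real d
  have hq1 : ∀ p, q p ≤ 1 := fun p => measureReal_le_one
  have hqm : Measurable fun x : Past A t => (κ t x).real d :=
    (Kernel.measurable_coe _ hd').ennreal_toReal
  have hqint : ∀ W : Set (Path A × Path B),
      ∫ p in W, q p ∂π = (∫⁻ p in W, κ t (past t p.1) d ∂π).toReal := fun W => by
    refine integral_toReal ?_ (Eventually.of_forall fun p => measure_lt_top _ _)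
    exact ((Kernel.measurable_coe _ hd').comp
      ((measurable_past t).comp measurable_fst)).aemeasurable
  -- The marginal disintegration `hd` identifies `q` as the conditional probability of `d` given the
  -- first past; causality then allows the extra event `a'` in the second past.
  have key := measureReal_inter_eq_setIntegral_of_condIndep _
    measurable_fst.comap_le
    ((MeasurableSpace.comap_mono ((Filtration.piLE (X := B)).le s)).trans
      measurable_snd.comap_le) (h s) (t₁ := {p | p.1 t ∈ d})
    ⟨{x | x t ∈ d}, measurable_pi_apply t hd', rfl⟩ (u := q)
    ((hqm.comp (measurable_past_piLE hts)).comp (comap_measurable Prod.fst))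
    (fun p => by rw [Real.norm_of_nonneg measureReal_nonneg]; exact hq1 p)
    (fun W hW => by
      obtain ⟨w, hw, rfl⟩ := measurableSet_comap_piLE_iff_past hst hW
      rw [hqint, ← hd.measure_fst_eq hw hd', measureReal_def]
      congr 2
      ext p
      exact and_comm)
    (s := {p | past t p.1 ∈ a}) ⟨past t ⁻¹' a, measurable_past_piLE hts ha, rfl⟩
    (t₂ := {p | past t p.2 ∈ a'}) ⟨past t ⁻¹' a', measurable_past_piLE hts ha', rfl⟩
  rw [hqint, measureReal_def, ENNReal.toReal_eq_toReal_iff' (measure_ne_top _ _)] at key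
  · convert key using 2
    · ext p
      exact and_comm
    · rfl
  · refine ne_top_of_le_ne_top (measure_ne_top π univ) ?_
    calc _ ≤ ∫⁻ p, 1 ∂π := by
          refine (setLIntegral_le_lintegral _ _).trans (lintegral_mono fun p => prob_le_one)
      _ = π univ := by simp

/-- Backward integration of an indicator down to date `t` gives a function `F` that serves as
conditional probability simultaneously under all restrictions of `π` to events known at date `t`.
This independence of the restriction is the conditional independence. -/
lemma isCausal_of_nonanticipativeAt {π : Measure (Path A × Path B)} [IsProbabilityMeasure π]
    (h : ∀ t, NonanticipativeAt κ π t) : IsCausal π := by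
  classical
  obtain ⟨b⟩ := π.nonempty_of_neZero
  intro t
  refine condIndep_of_forall_setIntegral_eq _ measurable_fst.comap_le
    ((MeasurableSpace.comap_mono ((Filtration.piLE (X := B)).le t)).trans
      measurable_snd.comap_le) ?_
  rintro _ ⟨a, ha, rfl⟩
  -- The integration stops at `t + 1`, so that the coordinate at `t` itself stays free and `F` is
  -- measurable for the filtration at `t`.
  obtain ⟨F, hF, hF1, hFd, hFint⟩ := exists_backward_integral κ b.1
    (f := a.indicator 1) (measurable_one.indicator ha)
    (fun x => indicator_le_self' (fun _ _ => zero_le) x) (Nat.succ_le_of_lt t.2)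
  have hFt : Measurable[Filtration.piLE (X := A) t] F :=
    measurable_piLE_of_dependsOn b.1 hF (hFd.mono fun r hr => Nat.lt_succ_iff.1 hr)
  refine ⟨fun p => (F p.1).toReal, hFt.ennreal_toReal.comp (comap_measurable Prod.fst),
    fun p => ?_, ?_⟩
  · rw [Real.norm_of_nonneg ENNReal.toReal_nonneg]
    exact ENNReal.toReal_le_of_le_ofReal zero_le_one (by simpa using hF1 p.1)
  rintro _ ⟨s, hs, rfl⟩ _ ⟨s', hs', rfl⟩
  have hsm : MeasurableSet s := Filtration.piLE.le t _ hs
  have hsm' : MeasurableSet s' := Filtration.piLE.le t _ hs'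
  have hWm : MeasurableSet (Prod.fst ⁻¹' s ∩ Prod.snd ⁻¹' s' : Set (Path A × Path B)) :=
    (measurable_fst hsm).inter (measurable_snd hsm')
  have key := hFint ((π.restrict (Prod.fst ⁻¹' s ∩ Prod.snd ⁻¹' s')).map Prod.fst) inferInstance
    fun r hr => (h r).disintegratesAt_restrict b hWm fun p q hp hq => and_congr
      (mem_iff_of_measurableSet_piLE hs fun i hi => hp i (hi.trans_lt hr))
      (mem_iff_of_measurableSet_piLE hs' fun i hi => hq i (hi.trans_lt hr))
  rw [lintegral_indicator_one ha, Measure.map_apply measurable_fst ha,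
    Measure.restrict_apply (measurable_fst ha), lintegral_map hF measurable_fst] at key
  rw [measureReal_def, key]
  exact (integral_toReal (hF.comp measurable_fst).aemeasurable
    (Eventually.of_forall fun p => (hF1 p.1).trans_lt ENNReal.one_lt_top)).symm

end StandardBorel

end Causality

/-! ### Integral identities -/

section IntegralIdentities

variable {T : ℕ} {A : Fin T → Type u} {B : Fin T → Type w} [∀ t, MeasurableSpace (A t)]
  [∀ t, MeasurableSpace (B t)] {κ : ∀ t, Kernel (Past A t) (A t)} [∀ t, IsMarkovKernel (κ t)]

lemma DisintegratesAt.integral_eq {μ : Measure (Path A)} [IsFiniteMeasure μ] {t : Fin T}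
    (h : DisintegratesAt κ μ t) {f : Past A t × A t → ℝ} (hf : StronglyMeasurable f) {C : ℝ}
    (hC : ∀ x, ‖f x‖ ≤ C) :
    ∫ x, f (past t x, x t) ∂μ = ∫ x, ∫ e, f (past t x, e) ∂(κ t (past t x)) ∂μ := by
  rw [← integral_map (measurable_past_prodMk_apply t).aemeasurable hf.aestronglyMeasurable, h,
    Measure.integral_compProd (Integrable.of_bound hf.aestronglyMeasurable C
      (Eventually.of_forall hC)),
    integral_map (measurable_past t).aemeasurable
      hf.integral_kernel_prod_right'.aestronglyMeasurable]

lemma NonanticipativeAt.integral_eq {π : Measure (Path A × Path B)} [IsFiniteMeasure π] {t : Fin T}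
    (h : NonanticipativeAt κ π t) {f : (Past A t × Past B t) × A t → ℝ} (hf : StronglyMeasurable f)
    {C : ℝ} (hC : ∀ x, ‖f x‖ ≤ C) :
    ∫ p, f ((past t p.1, past t p.2), p.1 t) ∂π =
      ∫ p, ∫ e, f ((past t p.1, past t p.2), e) ∂(κ t (past t p.1)) ∂π := by
  rw [← integral_map (measurable_pasts_prodMk t).aemeasurable hf.aestronglyMeasurable, h,
    Measure.integral_compProd (Integrable.of_bound hf.aestronglyMeasurable C
      (Eventually.of_forall hC)),
    integral_map (measurable_pasts t).aemeasurable
      hf.integral_kernel_prod_right'.aestronglyMeasurable]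
  rfl

lemma nonanticipativeAt_of_forall_integral_eq [∀ t, TopologicalSpace (A t)]
    [∀ t, PolishSpace (A t)] [∀ t, BorelSpace (A t)] [∀ t, TopologicalSpace (B t)]
    [∀ t, PolishSpace (B t)] [∀ t, BorelSpace (B t)] {π : Measure (Path A × Path B)}
    [IsFiniteMeasure π] {t : Fin T}
    (h : ∀ f : ((Past A t × Past B t) × A t) →ᵇ ℝ,
      ∫ p, f ((past t p.1, past t p.2), p.1 t) ∂π =
        ∫ p, ∫ e, f ((past t p.1, past t p.2), e) ∂(κ t (past t p.1)) ∂π) :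
    NonanticipativeAt κ π t := by
  refine ext_of_forall_integral_eq_of_IsFiniteMeasure fun f => ?_
  have hf : StronglyMeasurable f := f.continuous.stronglyMeasurable
  rw [integral_map (measurable_pasts_prodMk t).aemeasurable hf.aestronglyMeasurable, h,
    Measure.integral_compProd (Integrable.of_bound hf.aestronglyMeasurable ‖f‖
      (Eventually.of_forall f.norm_coe_le_norm)),
    integral_map (measurable_pasts t).aemeasurable
      hf.integral_kernel_prod_right'.aestronglyMeasurable]
  rfl

end IntegralIdentities

/-! ### Pointwise minimization over a compact factor -/

/-- Compactness of `Z` makes the partial infimum continuous. Near-minimality is an open condition in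
`z`, so a dense sequence contains a near-minimizer for each `a`, and the law concentrated on the
graph of a selection attains the bound. -/
lemma exists_pointwise_min {A Z : Type*} [TopologicalSpace A] [MeasurableSpace A]
    [BorelSpace A] [SecondCountableTopology A] [TopologicalSpace Z] [CompactSpace Z]
    [MetrizableSpace Z] [MeasurableSpace Z] [BorelSpace Z] [Nonempty Z] (P : Measure A)
    [IsProbabilityMeasure P] (ψ : A × Z →ᵇ ℝ) :
    ∃ F : A →ᵇ ℝ, (∀ a z, F a ≤ ψ (a, z)) ∧ ∀ ε > 0, ∃ π : ProbabilityMeasure (A × Z),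
      (π : Measure (A × Z)).map Prod.fst = P ∧ ∫ p, ψ p ∂(π : Measure (A × Z)) ≤
        ∫ a, F a ∂P + ε := by
  classical
  let := metrizableSpaceMetric Z
  let m : A → ℝ := fun a => sInf ((fun z => ψ (a, z)) '' univ)
  have hbdd : ∀ a, BddBelow ((fun z => ψ (a, z)) '' univ) := fun a =>
    ⟨-‖ψ‖, by rintro _ ⟨z, -, rfl⟩; exact ψ.neg_norm_le_apply _⟩
  have hm : Continuous m :=
    isCompact_univ.continuous_sInf (f := fun a z => ψ (a, z)) ψ.continuous
  have hmle : ∀ a z, m a ≤ ψ (a, z) := fun a z => csInf_le (hbdd a) ⟨z, mem_univ z, rfl⟩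
  have hne : ∀ a, ((fun z => ψ (a, z)) '' univ).Nonempty := fun a =>
    univ_nonempty.image _
  let F : A →ᵇ ℝ := BoundedContinuousFunction.ofNormedAddCommGroup m hm ‖ψ‖ fun a => by
    rw [Real.norm_eq_abs, abs_le]
    refine ⟨le_csInf (hne a) ?_, (hmle a (Classical.arbitrary Z)).trans (ψ.apply_le_norm _)⟩
    rintro _ ⟨z, -, rfl⟩
    exact ψ.neg_norm_le_apply _
  refine ⟨F, hmle, fun ε hε => ?_⟩
  have hex : ∀ a, ∃ n, ψ (a, denseSeq Z n) < m a + ε := fun a => by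
    obtain ⟨_, ⟨z, -, rfl⟩, hz⟩ := exists_lt_of_csInf_lt (hne a) (lt_add_of_pos_right (m a) hε)
    have hopen : IsOpen {z | ψ (a, z) < m a + ε} :=
      isOpen_lt (ψ.continuous.comp (Continuous.prodMk_right a)) continuous_const
    obtain ⟨y, hy, n, rfl⟩ := (denseRange_denseSeq Z).inter_open_nonempty _ hopen ⟨z, hz⟩
    exact ⟨n, hy⟩
  -- The first admissible index gives a measurable choice without a general selection theorem.
  let σ : A → Z := fun a => denseSeq Z (Nat.find (hex a))
  have hσ : Measurable σ := by
    refine Measurable.find (f := fun n _ => denseSeq Z n) (fun n => measurable_const)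
      (p := fun n a => ψ (a, denseSeq Z n) < m a + ε) (fun n => ?_) hex
    exact (isOpen_lt (ψ.continuous.comp (Continuous.prodMk_left _))
      (hm.add continuous_const)).measurableSet
  have hσ' : ∀ a, ψ (a, σ a) < m a + ε := fun a => Nat.find_spec (hex a)
  have hgm : Measurable fun a => (a, σ a) := measurable_id.prodMk hσ
  refine ⟨⟨P.map fun a => (a, σ a), Measure.isProbabilityMeasure_map hgm.aemeasurable⟩,
    ?_, ?_⟩
  · rw [ProbabilityMeasure.coe_mk, Measure.map_map measurable_fst hgm]
    exact Measure.map_id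
  · rw [ProbabilityMeasure.coe_mk, integral_map hgm.aemeasurable
      ψ.continuous.aestronglyMeasurable]
    have hFi : Integrable F P := F.integrable P
    have : ∫ a, F a ∂P + ε = ∫ a, (F a + ε) ∂P := by
      rw [integral_add hFi (integrable_const _)]
      simp
    rw [this]
    refine integral_mono ?_ (hFi.add (integrable_const _)) fun a => (hσ' a).le
    exact Integrable.of_bound (ψ.continuous.stronglyMeasurable.measurable.comp
      hgm).aestronglyMeasurable ‖ψ‖ (Eventually.of_forall fun a => ψ.norm_coe_le_norm _)

/-! ### Test functions -/

section TestFunctions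

variable {T : ℕ} {𝒳 : Fin T → Type u} [∀ t, TopologicalSpace (𝒳 t)] [∀ t, MeasurableSpace (𝒳 t)]
  {𝒴 : Fin T → Type w} [∀ t, TopologicalSpace (𝒴 t)] {𝕏 : FilteredProcess.{u, v} 𝒳}

lemma FilteredProcess.disintegratesAt (𝕏 : FilteredProcess.{u, v} 𝒳) (t : Fin T) :
    DisintegratesAt 𝕏.kernel 𝕏.law t :=
  𝕏.disintegration t

lemma linear_mem_testG {G G' : Path 𝕏.Ω → Path (Info 𝒴) → ℝ} (hG : G ∈ testG 𝒴 𝕏)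
    (hG' : G' ∈ testG 𝒴 𝕏) (r r' : ℝ) :
    (fun ω z => r * G ω z + r' * G' ω z) ∈ testG 𝒴 𝕏 := by
  obtain ⟨a, ha⟩ := hG
  obtain ⟨a', ha'⟩ := hG'
  refine ⟨fun t => r • a t + r' • a' t, fun ω z => ?_⟩
  dsimp only
  rw [ha, ha', Finset.mul_sum, Finset.mul_sum, ← Finset.sum_add_distrib]
  refine Finset.sum_congr rfl fun t _ => ?_
  have hi : ∀ b : ((Past 𝕏.Ω t × 𝕏.Ω t) × Past (Info 𝒴) t) →ᵇ ℝ,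
      Integrable (fun e => b ((past t ω, e), past t z)) (𝕏.kernel t (past t ω)) := fun b =>
    Integrable.of_bound (b.continuous.comp (by fun_prop)).aestronglyMeasurable ‖b‖
      (Eventually.of_forall fun e => b.norm_coe_le_norm _)
  simp only [BoundedContinuousFunction.coe_add, BoundedContinuousFunction.coe_smul, Pi.add_apply,
    smul_eq_mul]
  rw [integral_add ((hi _).const_mul _) ((hi _).const_mul _), integral_const_mul,
    integral_const_mul]
  ring

lemma linear_mem_testH {H H' : Path 𝕏.Ω → Path (Info 𝒴) → ℝ} (hH : H ∈ testH 𝒴 𝕏)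
    (hH' : H' ∈ testH 𝒴 𝕏) (r r' : ℝ) :
    (fun ω z => r * H ω z + r' * H' ω z) ∈ testH 𝒴 𝕏 := by
  obtain ⟨a, ha⟩ := hH
  obtain ⟨a', ha'⟩ := hH'
  refine ⟨fun t => r • a t + r' • a' t, fun ω z => ?_⟩
  dsimp only
  rw [ha, ha', Finset.mul_sum, Finset.mul_sum, ← Finset.sum_add_distrib]
  refine Finset.sum_congr rfl fun t _ => ?_
  have hi : ∀ b : (Past 𝕏.Ω t × (Past (Info 𝒴) t × Info 𝒴 t)) →ᵇ ℝ,
      Integrable (fun e => b (past t ω, (past t z, e)))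
        (infoKernel t.1 t.2 (past t z) : Measure (Info 𝒴 t)) := fun b =>
    Integrable.of_bound (b.continuous.comp (by fun_prop)).aestronglyMeasurable ‖b‖
      (Eventually.of_forall fun e => b.norm_coe_le_norm _)
  simp only [BoundedContinuousFunction.coe_add, BoundedContinuousFunction.coe_smul, Pi.add_apply,
    smul_eq_mul]
  rw [integral_add ((hi _).const_mul _) ((hi _).const_mul _), integral_const_mul,
    integral_const_mul]
  ring

lemma single_mem_testG (t : Fin T) (ht : 0 < t.val)
    (a : ((Past 𝕏.Ω t × 𝕏.Ω t) × Past (Info 𝒴) t) →ᵇ ℝ) :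
    (fun ω z => a ((past t ω, ω t), past t z) -
      ∫ ω', a ((past t ω, ω'), past t z) ∂(𝕏.kernel t (past t ω))) ∈ testG 𝒴 𝕏 := by
  classical
  refine ⟨Pi.single t a, fun ω z => ?_⟩
  rw [Finset.sum_eq_single (⟨t, ht⟩ : {t : Fin T // 0 < t.val})]
  · simp
  · intro s _ hs
    have : (s : Fin T) ≠ t := fun h => hs (Subtype.ext h)
    simp [Pi.single_eq_of_ne this]
  · simp

lemma single_mem_testH (t : Fin T) (ht : 0 < t.val)
    (a : (Past 𝕏.Ω t × (Past (Info 𝒴) t × Info 𝒴 t)) →ᵇ ℝ) :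
    (fun ω z => a (past t ω, (past t z, z t)) -
      ∫ z', a (past t ω, (past t z, z')) ∂(infoKernel t ht (past t z) : Measure (Info 𝒴 t)))
      ∈ testH 𝒴 𝕏 := by
  classical
  refine ⟨Pi.single t a, fun ω z => ?_⟩
  rw [Finset.sum_eq_single (⟨t, ht⟩ : {t : Fin T // 0 < t.val})]
  · simp
  · intro s _ hs
    have : (s : Fin T) ≠ t := fun h => hs (Subtype.ext h)
    simp [Pi.single_eq_of_ne this]
  · simp

lemma zero_mem_testG : (fun _ _ => 0) ∈ testG 𝒴 𝕏 := ⟨fun _ => 0, by simp⟩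

lemma zero_mem_testH : (fun _ _ => 0) ∈ testH 𝒴 𝕏 := ⟨fun _ => 0, by simp⟩

lemma norm_integral_le_of_prob {E : Type*} [MeasurableSpace E] (μ : Measure E)
    [IsProbabilityMeasure μ] {f : E → ℝ} {C : ℝ} (h : ∀ e, ‖f e‖ ≤ C) : ‖∫ e, f e ∂μ‖ ≤ C := by
  simpa using norm_integral_le_of_norm_le_const (μ := μ) (Eventually.of_forall h)

/-- A bounded continuous function of paths is the sum of a function of the first coordinate and of
a test function. -/
lemma exists_eq_add_testG [NeZero T] (F : Path 𝕏.Ω →ᵇ ℝ) :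
    ∃ f : 𝕏.Ω 0 →ᵇ ℝ, ∃ G ∈ testG 𝒴 𝕏, (∀ ω z, F ω = f (ω 0) + G ω z) ∧
      ∫ ω, F ω ∂𝕏.law = ∫ ω, f (ω 0) ∂𝕏.law := by
  classical
  obtain ⟨b⟩ := 𝕏.law.nonempty_of_neZero
  -- Telescoping backward in time: replacing a function by its conditional expectation given the
  -- previous dates leaves a difference in `testG`, and weak continuity of the kernel keeps the new
  -- function continuous. The restriction `0 < s` stops before the first date, which has no term in
  -- `testG`.
  have key : ∀ s ≤ T, 0 < s → ∃ F' : Path 𝕏.Ω →ᵇ ℝ, DependsOn F' {r | r.val < s} ∧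
      ∃ G ∈ testG 𝒴 𝕏, (∀ ω z, F ω = F' ω + G ω z) ∧
        ∫ ω, F ω ∂𝕏.law = ∫ ω, F' ω ∂𝕏.law := by
    intro s hs
    induction hs using Nat.decreasingInduction with
    | self =>
      exact fun _ => ⟨F, fun x y h => congrArg F (funext fun r => h r r.2), _, zero_mem_testG,
        fun _ _ => (add_zero _).symm, rfl⟩
    | of_succ s hs ih =>
      intro hpos
      obtain ⟨F', hF'd, G, hG, hFG, hint⟩ := ih (Nat.succ_pos s)
      let r : Fin T := ⟨s, hs⟩
      have hFc : Continuous fun p : Past 𝕏.Ω r × 𝕏.Ω r => F' (splice b r p.1 p.2) :=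
        F'.continuous.comp (continuous_splice b r)
      let φ : (Past 𝕏.Ω r × 𝕏.Ω r) →ᵇ ℝ := BoundedContinuousFunction.ofNormedAddCommGroup _ hFc
        ‖F'‖ fun p => F'.norm_coe_le_norm _
      let F'' : Path 𝕏.Ω →ᵇ ℝ := BoundedContinuousFunction.ofNormedAddCommGroup
        (fun ω => ∫ e, φ (past r ω, e) ∂(𝕏.kernel r (past r ω)))
        ((continuous_integral_of_continuous (𝕏.kernel_continuous r) φ).comp (continuous_past r))
        ‖F'‖ fun ω => norm_integral_le_of_prob _ fun e => F'.norm_coe_le_norm _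
      have hφ : ∀ ω : Path 𝕏.Ω, F' ω = φ (past r ω, ω r) := fun ω => hF'd fun q hq => by
        rcases (Nat.lt_succ_iff.1 hq).lt_or_eq with h | h
        · exact (splice_of_lt b (past r ω) (ω r) (show q < r from h)).symm
        · obtain rfl : q = r := Fin.ext h
          simp
      let a : ((Past 𝕏.Ω r × 𝕏.Ω r) × Past (Info 𝒴) r) →ᵇ ℝ :=
        φ.compContinuous ⟨Prod.fst, continuous_fst⟩
      refine ⟨F'', fun x y h => ?_, _, linear_mem_testG hG (single_mem_testG r hpos a) 1 1,
        fun ω z => ?_, ?_⟩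
      · have : past r x = past r y := past_eq_iff.2 fun q hq => h q hq
        change ∫ e, φ (past r x, e) ∂(𝕏.kernel r (past r x)) = _
        rw [this]
        rfl
      · rw [hFG ω z, hφ]
        change _ = ∫ e, φ (past r ω, e) ∂(𝕏.kernel r (past r ω)) + (1 * G ω z +
          1 * (φ (past r ω, ω r) - ∫ e, φ (past r ω, e) ∂(𝕏.kernel r (past r ω))))
        ring
      · rw [hint, integral_congr_ae (Eventually.of_forall hφ)]
        exact (𝕏.disintegratesAt r).integral_eq φ.continuous.stronglyMeasurable
          φ.norm_coe_le_norm
  obtain ⟨F', hF'd, G, hG, hFG, hint⟩ := key 1 (Nat.one_le_iff_ne_zero.2 (NeZero.ne T)) one_pos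
  have hf : ∀ ω : Path 𝕏.Ω, F' ω = F' (Function.update b 0 (ω 0)) := fun ω => hF'd fun r hr => by
    obtain rfl : r = 0 := Fin.ext (by simpa using hr)
    simp
  let f : 𝕏.Ω 0 →ᵇ ℝ := F'.compContinuous
    ⟨fun e => Function.update b 0 e, continuous_const.update 0 continuous_id⟩
  refine ⟨f, G, hG, fun ω z => ?_, ?_⟩
  · rw [hFG ω z, hf]
    rfl
  · rw [hint]
    exact integral_congr_ae (Eventually.of_forall hf)

end TestFunctions

/-! ### Images of nonanticipative laws -/

section Images

variable {T : ℕ} {A A' : Fin T → Type u} {B B' : Fin T → Type w} [∀ t, MeasurableSpace (A t)]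
  [∀ t, MeasurableSpace (A' t)] [∀ t, MeasurableSpace (B t)] [∀ t, MeasurableSpace (B' t)]
  {κ : ∀ t, Kernel (Past A t) (A t)} [∀ t, IsMarkovKernel (κ t)]
  {κ' : ∀ t, Kernel (Past A' t) (A' t)} [∀ t, IsMarkovKernel (κ' t)]

lemma nonanticipativeAt_iff_lintegral {π : Measure (Path A × Path B)} [IsFiniteMeasure π]
    {t : Fin T} : NonanticipativeAt κ π t ↔
      ∀ f : (Past A t × Past B t) × A t → ℝ≥0∞, Measurable f →
        ∫⁻ p, f ((past t p.1, past t p.2), p.1 t) ∂π =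
          ∫⁻ p, ∫⁻ e, f ((past t p.1, past t p.2), e) ∂(κ t (past t p.1)) ∂π := by
  have hr : ∀ f : (Past A t × Past B t) × A t → ℝ≥0∞, Measurable f →
      ∫⁻ x, f x ∂((π.map fun p => (past t p.1, past t p.2)) ⊗ₘ
        ((κ t).comap Prod.fst measurable_fst)) =
      ∫⁻ p, ∫⁻ e, f ((past t p.1, past t p.2), e) ∂(κ t (past t p.1)) ∂π := fun f hf => by
    rw [Measure.lintegral_compProd hf, lintegral_map hf.lintegral_kernel_prod_right'
      (measurable_pasts t)]
    rfl
  constructor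
  · intro h f hf
    rw [← hr f hf, ← h, lintegral_map hf (measurable_pasts_prodMk t)]
  · intro h
    refine Measure.ext_of_lintegral _ fun f hf => ?_
    rw [hr f hf, lintegral_map hf (measurable_pasts_prodMk t), h f hf]

/-- Transfers the property along adapted maps of the two path spaces, provided `κ'` at the image
past is the image of `κ`, so that the new conditional law depends only on the new past. Here it
carries couplings to the information space. -/
lemma NonanticipativeAt.map {π : Measure (Path A × Path B)} [IsFiniteMeasure π] {t : Fin T}
    (h : NonanticipativeAt κ π t) {J : Path A → Path A'} (hJ : Measurable J)
    {J' : Path B → Path B'} (hJ' : Measurable J') {Jp : Past A t → Past A' t}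
    {Jp' : Past B t → Past B' t} (hJpm' : Measurable Jp') {Je : Past A t → A t → A' t}
    (hJpm : Measurable Jp) (hJem : Measurable (Function.uncurry Je))
    (hJp : ∀ x, past t (J x) = Jp (past t x)) (hJp' : ∀ x, past t (J' x) = Jp' (past t x))
    (hJe : ∀ x, J x t = Je (past t x) (x t))
    (hκ : ∀ g, κ' t (Jp g) = (κ t g).map (Je g)) :
    NonanticipativeAt κ' (π.map (Prod.map J J')) t := by
  rw [nonanticipativeAt_iff_lintegral] at h ⊢
  intro f hf
  have hm : Measurable fun p : Path A' × Path B' =>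
      ∫⁻ e, f ((past t p.1, past t p.2), e) ∂(κ' t (past t p.1)) :=
    (hf.lintegral_kernel_prod_right' (κ := (κ' t).comap Prod.fst measurable_fst)).comp
      (measurable_pasts t)
  have hm₀ : Measurable fun p : Path A' × Path B' => f ((past t p.1, past t p.2), p.1 t) :=
    hf.comp (measurable_pasts_prodMk t)
  rw [lintegral_map hm₀ (hJ.prodMap hJ'),
    lintegral_map hm (hJ.prodMap hJ')]
  simp only [Prod.map_fst, Prod.map_snd, hJp, hJp', hJe, hκ]
  rw [h fun x => f ((Jp x.1.1, Jp' x.1.2), Je x.1.1 x.2)]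
  · refine lintegral_congr fun p => ?_
    have h1 : Measurable fun e => f ((Jp (past t p.1), Jp' (past t p.2)), e) :=
      hf.comp measurable_prodMk_left
    have h2 : Measurable (Je (past t p.1)) := hJem.comp measurable_prodMk_left
    exact (lintegral_map h1 h2).symm
  · exact hf.comp (((hJpm.comp (measurable_fst.comp measurable_fst)).prodMk
      (hJpm'.comp (measurable_snd.comp measurable_fst))).prodMk
      (hJem.comp ((measurable_fst.comp measurable_fst).prodMk measurable_snd)))

end Images

/-! ### The information map of a filtered process -/

section InfoMap

variable {T : ℕ} {𝒴 : Fin T → Type w} [∀ t, TopologicalSpace (𝒴 t)] [∀ t, MeasurableSpace (𝒴 t)]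

/-- The conditional law, given the coordinates before `t`, of a function of the path, as a function
of the path. -/
noncomputable def FilteredProcess.condLaw (𝕐 : FilteredProcess.{w, v} 𝒴) (t : Fin T) {E : Type*}
    [TopologicalSpace E] [MeasurableSpace E] [BorelSpace E] (φ : C(Path 𝕐.Ω, E)) (ω : Path 𝕐.Ω) :
    ProbabilityMeasure E :=
  ⟨(𝕐.kernel t (past t ω)).map fun e => φ (Function.update ω t e),
    Measure.isProbabilityMeasure_map
      (φ.continuous.comp (continuous_const.update t continuous_id)).measurable.aemeasurable⟩

lemma FilteredProcess.continuous_condLaw (𝕐 : FilteredProcess.{w, v} 𝒴) (t : Fin T) {E : Type*}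
    [TopologicalSpace E] [MeasurableSpace E] [BorelSpace E] (φ : C(Path 𝕐.Ω, E)) :
    Continuous (𝕐.condLaw t φ) := by
  rw [ProbabilityMeasure.continuous_iff_forall_continuous_integral]
  intro g
  have hup : Continuous fun p : Path 𝕐.Ω × 𝕐.Ω t => Function.update p.1 t p.2 :=
    continuous_fst.update t continuous_snd
  let a : (Path 𝕐.Ω × 𝕐.Ω t) →ᵇ ℝ := g.compContinuous
    ⟨fun p => φ (Function.update p.1 t p.2), φ.continuous.comp hup⟩
  have := continuous_integral_of_continuous
    ((𝕐.kernel_continuous t).comp (continuous_past t)) a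
  convert this using 2 with ω
  exact integral_map (φ.continuous.comp (continuous_const.update t
    continuous_id)).measurable.aemeasurable g.continuous.aestronglyMeasurable

/-- The information process of a filtered process, as a function of the path. -/
noncomputable def FilteredProcess.infoMap (𝕐 : FilteredProcess.{w, v} 𝒴) :
    (t : Fin T) → C(Path 𝕐.Ω, Info 𝒴 t)
  | ⟨t, ht⟩ =>
    if h : t + 1 < T then
      ⟨fun ω => Info.mk h (𝕐.X ⟨t, ht⟩ ω) (𝕐.condLaw ⟨t + 1, h⟩ (𝕐.infoMap ⟨t + 1, h⟩) ω),
        (Info.continuous_mk h).comp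
          ((𝕐.X_continuous _).prodMk (𝕐.continuous_condLaw _ _))⟩
    else ⟨fun ω => Info.mkLast h (𝕐.X ⟨t, ht⟩ ω),
      (Info.continuous_mkLast h).comp (𝕐.X_continuous _)⟩
termination_by t => T - t.val

variable (𝕐 : FilteredProcess.{w, v} 𝒴)

lemma FilteredProcess.infoMap_apply_of_lt {t : ℕ} (h : t + 1 < T) (ω : Path 𝕐.Ω) :
    𝕐.infoMap ⟨t, by omega⟩ ω = Info.mk h (𝕐.X ⟨t, by omega⟩ ω)
      (𝕐.condLaw ⟨t + 1, h⟩ (𝕐.infoMap ⟨t + 1, h⟩) ω) := by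
  rw [infoMap, dif_pos h]
  rfl

lemma FilteredProcess.infoMap_apply_of_not_lt {t : Fin T} (h : ¬ t.val + 1 < T) (ω : Path 𝕐.Ω) :
    𝕐.infoMap t ω = Info.mkLast h (𝕐.X t ω) := by
  obtain ⟨t, ht⟩ := t
  rw [infoMap, dif_neg h]
  rfl

lemma FilteredProcess.state_infoMap (t : Fin T) (ω : Path 𝕐.Ω) :
    (𝕐.infoMap t ω).state = 𝕐.X t ω := by
  by_cases h : t.val + 1 < T
  · rw [show t = ⟨t.val, t.2⟩ from rfl, 𝕐.infoMap_apply_of_lt h, Info.state_mk]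
  · rw [𝕐.infoMap_apply_of_not_lt h, Info.state_mkLast]

lemma FilteredProcess.dependsOn_X [∀ t, MeasurableSingletonClass (𝒴 t)] (t : Fin T) :
    DependsOn (𝕐.X t) (Iic t) :=
  dependsOn_of_measurable_piLE (𝕐.X_adapted t)

/-- The information process is adapted: the conditional law stored at `t` resamples the coordinate
at `t + 1`, and by the backward recursion later coordinates have no influence. -/
lemma FilteredProcess.dependsOn_infoMap [∀ t, MeasurableSingletonClass (𝒴 t)] :
    ∀ t : Fin T, DependsOn (𝕐.infoMap t) (Iic t)
  | ⟨t, ht⟩ => by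
    intro x y hxy
    by_cases h : t + 1 < T
    · rw [𝕐.infoMap_apply_of_lt h, 𝕐.infoMap_apply_of_lt h, 𝕐.dependsOn_X _ hxy]
      congr 1
      refine Subtype.ext ?_
      have hp : past ⟨t + 1, h⟩ x = past ⟨t + 1, h⟩ y :=
        past_eq_iff.2 fun s hs => hxy s (Nat.lt_succ_iff.1 (Fin.lt_def.1 hs))
      simp only [condLaw, hp]
      congr 1
      funext e
      refine FilteredProcess.dependsOn_infoMap ⟨t + 1, h⟩ fun s hs => ?_
      rcases eq_or_ne s ⟨t + 1, h⟩ with rfl | hne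
      · simp
      · rw [Function.update_of_ne hne, Function.update_of_ne hne]
        exact hxy s (Nat.lt_succ_iff.1 (Fin.lt_def.1 (lt_of_le_of_ne hs hne)))
    · rw [𝕐.infoMap_apply_of_not_lt h, 𝕐.infoMap_apply_of_not_lt h, 𝕐.dependsOn_X _ hxy]
termination_by t => T - t.val

/-- The path of the information process. -/
noncomputable def FilteredProcess.infoPath (ω : Path 𝕐.Ω) : Path (Info 𝒴) :=
  fun t => 𝕐.infoMap t ω

lemma FilteredProcess.continuous_infoPath : Continuous 𝕐.infoPath :=
  continuous_pi fun t => (𝕐.infoMap t).continuous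

lemma FilteredProcess.infoState_infoPath (ω : Path 𝕐.Ω) : infoState (𝕐.infoPath ω) = 𝕐.path ω :=
  funext fun t => 𝕐.state_infoMap t ω

/-- The information process was built for this identity: the law stored at the previous date is the
conditional law of the present point, whatever `𝕐` is. -/
lemma FilteredProcess.infoKernel_infoPath : ∀ (t : Fin T) (ht : 0 < t.val) (ω : Path 𝕐.Ω),
    infoKernel t ht (past t (𝕐.infoPath ω)) = 𝕐.condLaw t (𝕐.infoMap t) ω
  | ⟨0, _⟩, h, _ => absurd h (lt_irrefl 0)
  | ⟨t + 1, ht⟩, _, ω => by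
    change Info.next ht (𝕐.infoMap ⟨t, _⟩ ω) = _
    rw [𝕐.infoMap_apply_of_lt ht, Info.next_mk]

end InfoMap

/-! ### The canonical kernels -/

section CanonicalKernel

variable {T : ℕ} {𝒴 : Fin T → Type w} [∀ t, TopologicalSpace (𝒴 t)] [∀ t, CompactSpace (𝒴 t)]
  [∀ t, MetrizableSpace (𝒴 t)] [∀ t, Nonempty (𝒴 t)]

/-- The successive kernels on `𝒵`: the first one is the first marginal of `ν`, the other ones are
the canonical kernels. -/
noncomputable def canonicalKernel (ν : Measure (Path (Info 𝒴))) (t : Fin T) :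
    Kernel (Past (Info 𝒴) t) (Info 𝒴 t) :=
  if h : 0 < t.val then
    ⟨fun z => infoKernel t h z, measurable_of_continuous_probabilityMeasure
      (continuous_infoKernel t h)⟩
  else Kernel.const _ (ν.map fun z => z t)

lemma canonicalKernel_apply (ν : Measure (Path (Info 𝒴))) {t : Fin T} (h : 0 < t.val)
    (z : Past (Info 𝒴) t) :
    canonicalKernel ν t z = (infoKernel t h z : Measure (Info 𝒴 t)) := by
  rw [canonicalKernel, dif_pos h]
  rfl

lemma canonicalKernel_apply_of_val_eq_zero (ν : Measure (Path (Info 𝒴))) {t : Fin T}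
    (h : t.val = 0) (z : Past (Info 𝒴) t) : canonicalKernel ν t z = ν.map fun z => z t := by
  rw [canonicalKernel, dif_neg (by omega), Kernel.const_apply]

instance (ν : Measure (Path (Info 𝒴))) [IsProbabilityMeasure ν] (t : Fin T) :
    IsMarkovKernel (canonicalKernel ν t) := by
  refine ⟨fun z => ?_⟩
  rcases Nat.eq_zero_or_pos t.val with h | h
  · rw [canonicalKernel_apply_of_val_eq_zero ν h]
    exact Measure.isProbabilityMeasure_map (measurable_pi_apply t).aemeasurable
  · rw [canonicalKernel_apply ν h]
    infer_instance

end CanonicalKernel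

/-! ### Integrals of test functions -/

section TestIntegrals

variable {T : ℕ} {𝒳 : Fin T → Type u} [∀ t, TopologicalSpace (𝒳 t)] [∀ t, MeasurableSpace (𝒳 t)]
  {𝒴 : Fin T → Type w} [∀ t, TopologicalSpace (𝒴 t)] [∀ t, CompactSpace (𝒴 t)]
  [∀ t, MetrizableSpace (𝒴 t)] [∀ t, Nonempty (𝒴 t)] {𝕏 : FilteredProcess.{u, v} 𝒳}

/-- A term of a test function in `testG`, as a bounded continuous function. -/
noncomputable def termG (𝕏 : FilteredProcess.{u, v} 𝒳) (t : Fin T)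
    (a : ((Past 𝕏.Ω t × 𝕏.Ω t) × Past (Info 𝒴) t) →ᵇ ℝ) :
    (Path 𝕏.Ω × Path (Info 𝒴)) →ᵇ ℝ :=
  a.compContinuous ⟨fun p => ((past t p.1, p.1 t), past t p.2), by fun_prop⟩ -
  BoundedContinuousFunction.ofNormedAddCommGroup
    (fun p => ∫ e, a ((past t p.1, e), past t p.2) ∂(𝕏.kernel t (past t p.1)))
    (continuous_integral_of_continuous
      ((𝕏.kernel_continuous t).comp ((continuous_past t).comp continuous_fst))
      (a.compContinuous ⟨fun p : (Path 𝕏.Ω × Path (Info 𝒴)) × 𝕏.Ω t =>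
        ((past t p.1.1, p.2), past t p.1.2), by fun_prop⟩))
    ‖a‖ (fun _ => norm_integral_le_of_prob _ fun _ => a.norm_coe_le_norm _)

lemma termG_apply (t : Fin T) (a : ((Past 𝕏.Ω t × 𝕏.Ω t) × Past (Info 𝒴) t) →ᵇ ℝ)
    (ω : Path 𝕏.Ω) (z : Path (Info 𝒴)) :
    termG 𝕏 t a (ω, z) = a ((past t ω, ω t), past t z) -
      ∫ e, a ((past t ω, e), past t z) ∂(𝕏.kernel t (past t ω)) := rfl

/-- A term of a test function in `testH`, as a bounded continuous function. -/
noncomputable def termH (𝕏 : FilteredProcess.{u, v} 𝒳) (t : Fin T) (ht : 0 < t.val)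
    (a : (Past 𝕏.Ω t × (Past (Info 𝒴) t × Info 𝒴 t)) →ᵇ ℝ) :
    (Path 𝕏.Ω × Path (Info 𝒴)) →ᵇ ℝ :=
  a.compContinuous ⟨fun p => (past t p.1, (past t p.2, p.2 t)), by fun_prop⟩ -
  BoundedContinuousFunction.ofNormedAddCommGroup
    (fun p => ∫ e, a (past t p.1, (past t p.2, e))
      ∂(infoKernel t ht (past t p.2) : Measure (Info 𝒴 t)))
    (continuous_integral_of_continuous
      ((continuous_infoKernel t ht).comp ((continuous_past t).comp continuous_snd))
      (a.compContinuous ⟨fun p : (Path 𝕏.Ω × Path (Info 𝒴)) × Info 𝒴 t =>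
        (past t p.1.1, (past t p.1.2, p.2)), by fun_prop⟩))
    ‖a‖ (fun _ => norm_integral_le_of_prob _ fun _ => a.norm_coe_le_norm _)

lemma termH_apply (t : Fin T) (ht : 0 < t.val)
    (a : (Past 𝕏.Ω t × (Past (Info 𝒴) t × Info 𝒴 t)) →ᵇ ℝ)
    (ω : Path 𝕏.Ω) (z : Path (Info 𝒴)) :
    termH 𝕏 t ht a (ω, z) = a (past t ω, (past t z, z t)) -
      ∫ e, a (past t ω, (past t z, e)) ∂(infoKernel t ht (past t z) : Measure (Info 𝒴 t)) := rfl

lemma integral_termG (t : Fin T) (a : ((Past 𝕏.Ω t × 𝕏.Ω t) × Past (Info 𝒴) t) →ᵇ ℝ)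
    (π : Measure (Path 𝕏.Ω × Path (Info 𝒴))) [IsProbabilityMeasure π] :
    ∫ p, termG 𝕏 t a p ∂π = ∫ p, a ((past t p.1, p.1 t), past t p.2) ∂π -
      ∫ p, ∫ e, a ((past t p.1, e), past t p.2) ∂(𝕏.kernel t (past t p.1)) ∂π :=
  integral_sub (BoundedContinuousFunction.integrable π _)
    (BoundedContinuousFunction.integrable π _)

lemma integral_termH (t : Fin T) (ht : 0 < t.val)
    (a : (Past 𝕏.Ω t × (Past (Info 𝒴) t × Info 𝒴 t)) →ᵇ ℝ)
    (π : Measure (Path 𝕏.Ω × Path (Info 𝒴))) [IsProbabilityMeasure π] :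
    ∫ p, termH 𝕏 t ht a p ∂π = ∫ p, a (past t p.1, (past t p.2, p.2 t)) ∂π -
      ∫ p, ∫ e, a (past t p.1, (past t p.2, e))
        ∂(infoKernel t ht (past t p.2) : Measure (Info 𝒴 t)) ∂π :=
  integral_sub (BoundedContinuousFunction.integrable π _)
    (BoundedContinuousFunction.integrable π _)

lemma integral_termG_eq_zero {t : Fin T} {π : Measure (Path 𝕏.Ω × Path (Info 𝒴))}
    [IsProbabilityMeasure π] (h : NonanticipativeAt 𝕏.kernel π t)
    (a : ((Past 𝕏.Ω t × 𝕏.Ω t) × Past (Info 𝒴) t) →ᵇ ℝ) : ∫ p, termG 𝕏 t a p ∂π = 0 := by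
  have hc : Continuous fun x : (Past 𝕏.Ω t × Past (Info 𝒴) t) × 𝕏.Ω t =>
      a ((x.1.1, x.2), x.1.2) := a.continuous.comp (by fun_prop)
  rw [integral_termG, sub_eq_zero]
  exact h.integral_eq hc.stronglyMeasurable fun x => a.norm_coe_le_norm _

/-- Bounded continuous functions determine finite measures, so the terms of `testG` detect
nonanticipativity completely. -/
lemma nonanticipativeAt_of_integral_termG {t : Fin T} {π : Measure (Path 𝕏.Ω × Path (Info 𝒴))}
    [IsProbabilityMeasure π] (h : ∀ a, ∫ p, termG 𝕏 t a p ∂π = 0) :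
    NonanticipativeAt 𝕏.kernel π t := by
  refine nonanticipativeAt_of_forall_integral_eq fun f => ?_
  have := h (f.compContinuous ⟨fun x => ((x.1.1, x.2), x.1.2), by fun_prop⟩)
  rw [integral_termG, sub_eq_zero] at this
  exact this

lemma integral_termH_eq_zero {t : Fin T} (ht : 0 < t.val)
    {π : Measure (Path 𝕏.Ω × Path (Info 𝒴))} [IsProbabilityMeasure π]
    {ν : Measure (Path (Info 𝒴))} [IsProbabilityMeasure ν]
    (h : NonanticipativeAt (canonicalKernel ν) (π.map Prod.swap) t)
    (a : (Past 𝕏.Ω t × (Past (Info 𝒴) t × Info 𝒴 t)) →ᵇ ℝ) :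
    ∫ p, termH 𝕏 t ht a p ∂π = 0 := by
  have hc : Continuous fun x : (Past (Info 𝒴) t × Past 𝕏.Ω t) × Info 𝒴 t =>
      a (x.1.2, (x.1.1, x.2)) := a.continuous.comp (by fun_prop)
  have key := h.integral_eq hc.stronglyMeasurable (C := ‖a‖) fun x => a.norm_coe_le_norm _
  have hk : StronglyMeasurable fun p : Path (Info 𝒴) × Path 𝕏.Ω =>
      ∫ e, a (past t p.2, (past t p.1, e)) ∂(canonicalKernel ν t (past t p.1)) :=
    (hc.stronglyMeasurable.integral_kernel_prod_right'
    (κ := (canonicalKernel ν t).comap Prod.fst measurable_fst)).comp_measurable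
      (measurable_pasts (A := Info 𝒴) (B := 𝕏.Ω) t)
  have hl : StronglyMeasurable fun p : Path (Info 𝒴) × Path 𝕏.Ω =>
      a (past t p.2, (past t p.1, p.1 t)) := by
    have : Continuous fun p : Path (Info 𝒴) × Path 𝕏.Ω =>
      a (past t p.2, (past t p.1, p.1 t)) := a.continuous.comp (by fun_prop)
    exact this.stronglyMeasurable
  rw [integral_map measurable_swap.aemeasurable hl.aestronglyMeasurable,
    integral_map measurable_swap.aemeasurable hk.aestronglyMeasurable] at key
  simp only [canonicalKernel_apply ν ht, Prod.fst_swap, Prod.snd_swap] at key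
  rw [integral_termH, sub_eq_zero]
  exact key

/-- Here `ν` is arbitrary: it enters `canonicalKernel ν` only at the first date, which `ht`
excludes. -/
lemma nonanticipativeAt_of_integral_termH {t : Fin T} (ht : 0 < t.val)
    {π : Measure (Path 𝕏.Ω × Path (Info 𝒴))} [IsProbabilityMeasure π]
    (h : ∀ a, ∫ p, termH 𝕏 t ht a p ∂π = 0) (ν : Measure (Path (Info 𝒴)))
    [IsProbabilityMeasure ν] :
    NonanticipativeAt (canonicalKernel ν) (π.map Prod.swap) t := by
  refine nonanticipativeAt_of_forall_integral_eq fun f => ?_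
  have := h (f.compContinuous ⟨fun x => ((x.2.1, x.1), x.2.2), by fun_prop⟩)
  rw [integral_termH, sub_eq_zero] at this
  have hk : StronglyMeasurable fun p : Path (Info 𝒴) × Path 𝕏.Ω =>
      ∫ e, f ((past t p.1, past t p.2), e) ∂(canonicalKernel ν t (past t p.1)) :=
    (f.continuous.stronglyMeasurable.integral_kernel_prod_right'
    (κ := (canonicalKernel ν t).comap Prod.fst measurable_fst)).comp_measurable
      (measurable_pasts (A := Info 𝒴) (B := 𝕏.Ω) t)
  have hl : StronglyMeasurable fun p : Path (Info 𝒴) × Path 𝕏.Ω =>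
      f ((past t p.1, past t p.2), p.1 t) := by
    have : Continuous fun p : Path (Info 𝒴) × Path 𝕏.Ω =>
      f ((past t p.1, past t p.2), p.1 t) := f.continuous.comp (by fun_prop)
    exact this.stronglyMeasurable
  rw [integral_map measurable_swap.aemeasurable hl.aestronglyMeasurable,
    integral_map measurable_swap.aemeasurable hk.aestronglyMeasurable]
  simp only [canonicalKernel_apply ν ht, Prod.fst_swap, Prod.snd_swap]
  exact this

lemma exists_boundedContinuous_of_mem_testG {G : Path 𝕏.Ω → Path (Info 𝒴) → ℝ}
    (hG : G ∈ testG 𝒴 𝕏) : ∃ Gb : (Path 𝕏.Ω × Path (Info 𝒴)) →ᵇ ℝ, (∀ ω z, G ω z = Gb (ω, z)) ∧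
      ∀ π : Measure (Path 𝕏.Ω × Path (Info 𝒴)), IsProbabilityMeasure π →
        (∀ t, NonanticipativeAt 𝕏.kernel π t) → ∫ p, Gb p ∂π = 0 := by
  obtain ⟨a, ha⟩ := hG
  refine ⟨∑ t : {t : Fin T // 0 < t.val}, termG 𝕏 t.1 (a t.1), fun ω z => ?_, fun π _ h => ?_⟩
  · rw [ha, BoundedContinuousFunction.sum_apply]
    rfl
  · simp only [BoundedContinuousFunction.sum_apply]
    rw [integral_finsetSum _ fun t _ => BoundedContinuousFunction.integrable π _]
    exact Finset.sum_eq_zero fun t _ => integral_termG_eq_zero (h t) _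

lemma exists_boundedContinuous_of_mem_testH {H : Path 𝕏.Ω → Path (Info 𝒴) → ℝ}
    (hH : H ∈ testH 𝒴 𝕏) : ∃ Hb : (Path 𝕏.Ω × Path (Info 𝒴)) →ᵇ ℝ, (∀ ω z, H ω z = Hb (ω, z)) ∧
      ∀ π : Measure (Path 𝕏.Ω × Path (Info 𝒴)), IsProbabilityMeasure π →
        ∀ ν : Measure (Path (Info 𝒴)), IsProbabilityMeasure ν →
        (∀ t : Fin T, 0 < t.val → NonanticipativeAt (canonicalKernel ν) (π.map Prod.swap) t) →
          ∫ p, Hb p ∂π = 0 := by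
  obtain ⟨a, ha⟩ := hH
  refine ⟨∑ t : {t : Fin T // 0 < t.val}, termH 𝕏 t.1 t.2 (a t.1), fun ω z => ?_,
    fun π _ ν _ h => ?_⟩
  · rw [ha, BoundedContinuousFunction.sum_apply]
    rfl
  · simp only [BoundedContinuousFunction.sum_apply]
    rw [integral_finsetSum _ fun t _ => BoundedContinuousFunction.integrable π _]
    exact Finset.sum_eq_zero fun t _ => integral_termH_eq_zero t.2 (h t t.2) _

end TestIntegrals

/-! ### Weak duality -/

section WeakDuality

variable {T : ℕ} {𝒳 : Fin T → Type u} [∀ t, TopologicalSpace (𝒳 t)] [∀ t, MeasurableSpace (𝒳 t)]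
  {𝒴 : Fin T → Type w} [∀ t, TopologicalSpace (𝒴 t)] [∀ t, CompactSpace (𝒴 t)]
  [∀ t, MetrizableSpace (𝒴 t)] [∀ t, Nonempty (𝒴 t)] [∀ t, MeasurableSpace (𝒴 t)]
  [∀ t, BorelSpace (𝒴 t)]

lemma nonanticipativeAt_map_infoPath_fst {𝕏 : FilteredProcess.{u, v} 𝒳}
    {𝕐 : FilteredProcess.{w, w} 𝒴} {π : ProbabilityMeasure (Path 𝕏.Ω × Path 𝕐.Ω)}
    (h : π ∈ bicausalCouplings 𝕏 𝕐) (t : Fin T) :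
    NonanticipativeAt 𝕏.kernel
      ((π : Measure (Path 𝕏.Ω × Path 𝕐.Ω)).map (Prod.map id 𝕐.infoPath)) t := by
  obtain ⟨b⟩ := 𝕐.law.nonempty_of_neZero
  obtain ⟨hcpl, hc, -⟩ := h
  have h1 : NonanticipativeAt 𝕏.kernel (π : Measure (Path 𝕏.Ω × Path 𝕐.Ω)) t :=
    hc.nonanticipativeAt (by rw [hcpl.map_fst]; exact 𝕏.disintegratesAt t)
  have hs : Measurable fun g : Past 𝕐.Ω t => past t (𝕐.infoPath (splice b t g (b t))) :=
    (measurable_past t).comp (𝕐.continuous_infoPath.measurable.comp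
      ((measurable_splice b t).comp (measurable_id.prodMk measurable_const)))
  refine h1.map measurable_id 𝕐.continuous_infoPath.measurable hs (Jp := id)
    (Je := fun _ e => e) measurable_id measurable_snd (fun x => rfl) (fun y => ?_) (fun x => rfl)
    (fun g => Measure.map_id.symm)
  -- Adaptedness of the information map makes its past a function of the past of `y`; the filler `b`
  -- plays no role.
  refine past_eq_iff.2 fun s hst => 𝕐.dependsOn_infoMap s fun r hr => ?_
  exact (splice_of_lt b (past t y) (b t) (lt_of_le_of_lt hr hst)).symm

lemma nonanticipativeAt_map_infoPath_snd {𝕏 : FilteredProcess.{u, v} 𝒳}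
    {𝕐 : FilteredProcess.{w, w} 𝒴} {π : ProbabilityMeasure (Path 𝕏.Ω × Path 𝕐.Ω)}
    (h : π ∈ bicausalCouplings 𝕏 𝕐) {t : Fin T} (ht : 0 < t.val) (ν : Measure (Path (Info 𝒴)))
    [IsProbabilityMeasure ν] :
    NonanticipativeAt (canonicalKernel ν)
      (((π : Measure (Path 𝕏.Ω × Path 𝕐.Ω)).map (Prod.map id 𝕐.infoPath)).map Prod.swap) t := by
  obtain ⟨b⟩ := 𝕐.law.nonempty_of_neZero
  obtain ⟨hcpl, -, hc⟩ := h
  have : IsProbabilityMeasure ((π : Measure (Path 𝕏.Ω × Path 𝕐.Ω)).map Prod.swap) :=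
    Measure.isProbabilityMeasure_map measurable_swap.aemeasurable
  have h1 : NonanticipativeAt 𝕐.kernel ((π : Measure (Path 𝕏.Ω × Path 𝕐.Ω)).map Prod.swap) t := by
    refine hc.nonanticipativeAt ?_
    rw [Measure.map_map measurable_fst measurable_swap]
    change DisintegratesAt _ (Measure.map Prod.snd _) t
    rw [hcpl.map_snd]
    exact 𝕐.disintegratesAt t
  have hJ := 𝕐.continuous_infoPath.measurable
  have hs : Measurable fun g : Past 𝕐.Ω t => past t (𝕐.infoPath (splice b t g (b t))) :=
    (measurable_past t).comp (hJ.comp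
      ((measurable_splice b t).comp (measurable_id.prodMk measurable_const)))
  have he : Measurable fun p : Past 𝕐.Ω t × 𝕐.Ω t => 𝕐.infoMap t (splice b t p.1 p.2) :=
    (𝕐.infoMap t).continuous.measurable.comp (measurable_splice b t)
  have h2 : ((π : Measure (Path 𝕏.Ω × Path 𝕐.Ω)).map (Prod.map id 𝕐.infoPath)).map Prod.swap =
      ((π : Measure (Path 𝕏.Ω × Path 𝕐.Ω)).map Prod.swap).map (Prod.map 𝕐.infoPath id) := by
    rw [Measure.map_map measurable_swap (measurable_id.prodMap hJ),
      Measure.map_map (hJ.prodMap measurable_id) measurable_swap]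
    rfl
  rw [h2]
  refine h1.map hJ measurable_id (Jp' := id) measurable_id hs
    (Je := fun g e => 𝕐.infoMap t (splice b t g e)) he (fun y => ?_) (fun x => rfl) (fun y => ?_)
    (fun g => ?_)
  · refine past_eq_iff.2 fun s hst => 𝕐.dependsOn_infoMap s fun r hr => ?_
    exact (splice_of_lt b (past t y) (b t) (lt_of_le_of_lt hr hst)).symm
  · refine 𝕐.dependsOn_infoMap t fun r hr => ?_
    rcases (show r ≤ t from hr).lt_or_eq with hlt | rfl
    · exact (splice_of_lt b (past t y) (y t) hlt).symm
    · exact (splice_self b r (past r y) (y r)).symm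
  -- The image under the information map of the kernel of `𝕐` is the law stored in the previous
  -- information point, which is the canonical kernel.
  · rw [canonicalKernel_apply ν ht, 𝕐.infoKernel_infoPath]
    simp only [FilteredProcess.condLaw, ProbabilityMeasure.coe_mk, past_splice]
    congr 1
    funext e
    simp [splice]

/-- Weak duality. -/
lemma dualValue_le_barycenterValue [NeZero T] {N : ℕ} (c : Fin N → Path 𝒳 × Path 𝒴 → ℝ)
    (𝕏 : Fin N → FilteredProcess.{u, v} 𝒳) : dualValue c 𝕏 ≤ barycenterValue c 𝕏 := by
  refine iSup₂_le fun f hf => le_iInf fun 𝕐 => ?_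
  obtain ⟨g, hg, hfg⟩ := hf
  have hJ := 𝕐.continuous_infoPath.measurable
  have hg0 : ∀ i, Integrable (fun y => g i (𝕐.infoPath y 0)) 𝕐.law := fun i =>
    Integrable.of_bound ((g i).continuous.comp
      (𝕐.infoMap 0).continuous).aestronglyMeasurable ‖g i‖
      (Eventually.of_forall fun y => (g i).norm_coe_le_norm _)
  -- The zero-sum terms `g i` may be inserted because they are all integrated against the same law,
  -- that of `𝕐`; the inequality can then be proved index by index.
  have hsum : ∑ i, ∫ ω, f i (ω 0) ∂(𝕏 i).law =
      ∑ i, (∫ ω, f i (ω 0) ∂(𝕏 i).law + ∫ y, g i (𝕐.infoPath y 0) ∂𝕐.law) := by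
    rw [Finset.sum_add_distrib, ← integral_finsetSum _ fun i _ => hg0 i]
    simp [hg]
  rw [hsum, coe_sum_ereal]
  refine Finset.sum_le_sum fun i _ => le_iInf₂ fun π hπ => ?_
  obtain ⟨G, hG, H, hH, hle⟩ := hfg i
  obtain ⟨Gb, hGb, hGint⟩ := exists_boundedContinuous_of_mem_testG hG
  obtain ⟨Hb, hHb, hHint⟩ := exists_boundedContinuous_of_mem_testH hH
  let π' := (π : Measure (Path (𝕏 i).Ω × Path 𝕐.Ω)).map (Prod.map id 𝕐.infoPath)
  have hπ' : IsProbabilityMeasure π' :=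
    Measure.isProbabilityMeasure_map (measurable_id.prodMap hJ).aemeasurable
  have hG0 := hGint π' hπ' (nonanticipativeAt_map_infoPath_fst hπ)
  have hν : IsProbabilityMeasure (𝕐.law.map 𝕐.infoPath) :=
    Measure.isProbabilityMeasure_map hJ.aemeasurable
  have hH0 := hHint π' hπ' (𝕐.law.map 𝕐.infoPath) hν
    fun t ht => nonanticipativeAt_map_infoPath_snd hπ ht _
  -- A bounded minorant of the cost whose integral is exactly the dual contribution of index `i`.
  let h : (Path (𝕏 i).Ω × Path 𝕐.Ω) → ℝ := fun p =>
    f i (p.1 0) + g i (𝕐.infoPath p.2 0) - Gb (p.1, 𝕐.infoPath p.2) - Hb (p.1, 𝕐.infoPath p.2)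
  rw [integral_map (measurable_id.prodMap hJ).aemeasurable
    Gb.continuous.aestronglyMeasurable] at hG0
  rw [integral_map (measurable_id.prodMap hJ).aemeasurable
    Hb.continuous.aestronglyMeasurable] at hH0
  have hJc : Continuous fun p : Path (𝕏 i).Ω × Path 𝕐.Ω => (p.1, 𝕐.infoPath p.2) :=
    continuous_fst.prodMk (𝕐.continuous_infoPath.comp continuous_snd)
  have i1 : Integrable (fun p : Path (𝕏 i).Ω × Path 𝕐.Ω => f i (p.1 0))
      (π : Measure (Path (𝕏 i).Ω × Path 𝕐.Ω)) :=
    ((f i).compContinuous ⟨fun p : Path (𝕏 i).Ω × Path 𝕐.Ω => p.1 0, by fun_prop⟩).integrable _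
  have i2 : Integrable (fun p : Path (𝕏 i).Ω × Path 𝕐.Ω => g i (𝕐.infoPath p.2 0))
      (π : Measure (Path (𝕏 i).Ω × Path 𝕐.Ω)) :=
    ((g i).compContinuous ⟨fun p : Path (𝕏 i).Ω × Path 𝕐.Ω => 𝕐.infoPath p.2 0,
      (continuous_apply 0).comp (continuous_snd.comp hJc)⟩).integrable _
  have i3 : Integrable (fun p : Path (𝕏 i).Ω × Path 𝕐.Ω => Gb (p.1, 𝕐.infoPath p.2))
      (π : Measure (Path (𝕏 i).Ω × Path 𝕐.Ω)) :=
    (Gb.compContinuous ⟨_, hJc⟩).integrable _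
  have i4 : Integrable (fun p : Path (𝕏 i).Ω × Path 𝕐.Ω => Hb (p.1, 𝕐.infoPath p.2))
      (π : Measure (Path (𝕏 i).Ω × Path 𝕐.Ω)) :=
    (Hb.compContinuous ⟨_, hJc⟩).integrable _
  have i12 : Integrable (fun p : Path (𝕏 i).Ω × Path 𝕐.Ω => f i (p.1 0) + g i (𝕐.infoPath p.2 0))
      (π : Measure (Path (𝕏 i).Ω × Path 𝕐.Ω)) := i1.add i2
  have i123 : Integrable (fun p : Path (𝕏 i).Ω × Path 𝕐.Ω =>
      f i (p.1 0) + g i (𝕐.infoPath p.2 0) - Gb (p.1, 𝕐.infoPath p.2))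
      (π : Measure (Path (𝕏 i).Ω × Path 𝕐.Ω)) := i12.sub i3
  have ih : Integrable h (π : Measure (Path (𝕏 i).Ω × Path 𝕐.Ω)) := i123.sub i4
  have hint : ∫ p, h p ∂(π : Measure (Path (𝕏 i).Ω × Path 𝕐.Ω)) =
      ∫ ω, f i (ω 0) ∂(𝕏 i).law + ∫ y, g i (𝕐.infoPath y 0) ∂𝕐.law := by
    simp only [h]
    rw [integral_sub i123 i4, integral_sub i12 i3, integral_add i1 i2]
    have e3 : ∫ p, Gb (p.1, 𝕐.infoPath p.2) ∂(π : Measure (Path (𝕏 i).Ω × Path 𝕐.Ω)) = 0 := hG0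
    have e4 : ∫ p, Hb (p.1, 𝕐.infoPath p.2) ∂(π : Measure (Path (𝕏 i).Ω × Path 𝕐.Ω)) = 0 := hH0
    have e1 : ∫ ω, f i (ω 0) ∂(𝕏 i).law =
        ∫ p, f i (p.1 0) ∂(π : Measure (Path (𝕏 i).Ω × Path 𝕐.Ω)) := by
      rw [← hπ.1.map_fst]
      exact integral_map measurable_fst.aemeasurable
        ((f i).continuous.comp (continuous_apply 0)).aestronglyMeasurable
    have e2 : ∫ y, g i (𝕐.infoPath y 0) ∂𝕐.law =
        ∫ p, g i (𝕐.infoPath p.2 0) ∂(π : Measure (Path (𝕏 i).Ω × Path 𝕐.Ω)) := by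
      rw [← hπ.1.map_snd]
      exact integral_map measurable_snd.aemeasurable
        ((g i).continuous.comp (𝕐.infoMap 0).continuous).aestronglyMeasurable
    rw [e1, e2, e3, e4]
    ring
  rw [← hint, ← expectation_eq_integral ih]
  refine expectation_mono _ fun p => ?_
  have := hle p.1 (𝕐.infoPath p.2)
  rw [hGb, hHb, 𝕐.infoState_infoPath] at this
  change f i (p.1 0) + g i (𝕐.infoPath p.2 0) - Gb (p.1, 𝕐.infoPath p.2) -
    Hb (p.1, 𝕐.infoPath p.2) ≤ _
  linarith

end WeakDuality

/-! ### Mixtures of probability measures -/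

lemma exists_convexCombination {E : Type*} [MeasurableSpace E] (μ ν : ProbabilityMeasure E)
    {a b : ℝ} (ha : 0 ≤ a) (hb : 0 ≤ b) (hab : a + b = 1) : ∃ ρ : ProbabilityMeasure E,
      (ρ : Measure E) =
        ENNReal.ofReal a • (μ : Measure E) + ENNReal.ofReal b • (ν : Measure E) := by
  refine ⟨⟨ENNReal.ofReal a • (μ : Measure E) + ENNReal.ofReal b • (ν : Measure E), ⟨?_⟩⟩, rfl⟩
  simp [← ENNReal.ofReal_add ha hb, hab]

/-! ### The canonical filtered process of a law on the information spaces -/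

section CanonicalProcess

lemma disintegratesAt_of_val_eq_zero {T : ℕ} {A : Fin T → Type u} [∀ t, MeasurableSpace (A t)]
    {κ : ∀ t, Kernel (Past A t) (A t)} [∀ t, IsMarkovKernel (κ t)] {μ : Measure (Path A)}
    [IsProbabilityMeasure μ] {t : Fin T} (ht : t.val = 0)
    (h : ∀ g, κ t g = μ.map fun x => x t) : DisintegratesAt κ μ t := by
  have := subsingleton_past (A := A) ht
  refine Measure.ext_prod fun {s d} hs hd => ?_
  rw [Measure.map_apply (by fun_prop) (hs.prod hd), Measure.compProd_apply_prod hs hd]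
  simp only [h]
  rw [lintegral_const, Measure.restrict_apply_univ, Measure.map_apply (measurable_past t) hs,
    Measure.map_apply (measurable_pi_apply t) hd]
  refine Subsingleton.set_cases (p := fun s : Set (Past A t) =>
    μ ((fun x => (past t x, x t)) ⁻¹' s ×ˢ d) =
      μ ((fun x => x t) ⁻¹' d) * μ (past t ⁻¹' s)) ?_ ?_ s
  · simp
  · simp only [preimage_univ, measure_univ, mul_one]
    congr 1
    ext x
    simp

variable {T : ℕ} {𝒴 : Fin T → Type w} [∀ t, TopologicalSpace (𝒴 t)] [∀ t, CompactSpace (𝒴 t)]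
  [∀ t, MetrizableSpace (𝒴 t)] [∀ t, Nonempty (𝒴 t)] [∀ t, MeasurableSpace (𝒴 t)]
  [∀ t, BorelSpace (𝒴 t)]

/-- The canonical filtered process: the coordinate process on the information spaces. -/
noncomputable abbrev canonicalProcess (ν : Measure (Path (Info 𝒴))) [IsProbabilityMeasure ν]
    (h : ∀ t, DisintegratesAt (canonicalKernel ν) ν t) : FilteredProcess.{w, w} 𝒴 where
  Ω := Info 𝒴
  law := ν
  kernel := canonicalKernel ν
  disintegration := h
  kernel_continuous t := by
    rcases Nat.eq_zero_or_pos t.val with ht | ht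
    · have := subsingleton_past (A := Info 𝒴) ht
      exact continuous_of_const fun x y => by rw [Subsingleton.elim x y]
    · refine (continuous_infoKernel t ht).congr fun z => ?_
      exact Subtype.ext (canonicalKernel_apply ν ht z).symm
  X t z := (z t).state
  X_continuous t := (Info.continuous_state t).comp (continuous_apply t)
  X_adapted t := by
    obtain ⟨b⟩ := ν.nonempty_of_neZero
    refine measurable_piLE_of_dependsOn b
      ((Info.continuous_state t).measurable.comp (measurable_pi_apply t)) fun x y hxy => ?_
    exact congrArg Info.state (hxy t (mem_Iic.2 le_rfl))

end CanonicalProcess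

/-! ### Strong duality -/

section StrongDuality

variable {T : ℕ} {𝒳 : Fin T → Type u} [∀ t, TopologicalSpace (𝒳 t)] [∀ t, MeasurableSpace (𝒳 t)]
  {𝒴 : Fin T → Type w} [∀ t, TopologicalSpace (𝒴 t)] [∀ t, CompactSpace (𝒴 t)]
  [∀ t, MetrizableSpace (𝒴 t)] [∀ t, Nonempty (𝒴 t)]

/-- The law conditions satisfied by the joint law of a filtered process and of the canonical
process of an information law `ν`. -/
structure IsCanonicalCoupling (𝕏 : FilteredProcess.{u, v} 𝒳) (ν : Measure (Path (Info 𝒴)))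
    (π : ProbabilityMeasure (Path 𝕏.Ω × Path (Info 𝒴))) : Prop where
  map_fst : (π : Measure (Path 𝕏.Ω × Path (Info 𝒴))).map Prod.fst = 𝕏.law
  map_snd : (π : Measure (Path 𝕏.Ω × Path (Info 𝒴))).map Prod.snd = ν
  nonanticipativeAt_fst : ∀ t, NonanticipativeAt 𝕏.kernel
    (π : Measure (Path 𝕏.Ω × Path (Info 𝒴))) t
  nonanticipativeAt_snd : ∀ t, NonanticipativeAt (canonicalKernel ν)
    ((π : Measure (Path 𝕏.Ω × Path (Info 𝒴))).map Prod.swap) t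

/-! ### From vanishing test integrals to bicausal couplings -/

section Canonical

variable {𝕏 : FilteredProcess.{u, v} 𝒳} {π : ProbabilityMeasure (Path 𝕏.Ω × Path (Info 𝒴))}

lemma map_swap_map_fst {A B : Type*} [MeasurableSpace A] [MeasurableSpace B]
    (π : Measure (A × B)) : (π.map Prod.swap).map Prod.fst = π.map Prod.snd := by
  rw [Measure.map_map measurable_fst measurable_swap]
  rfl

lemma disintegratesAt_of_integral_termH {ν : Measure (Path (Info 𝒴))} [IsProbabilityMeasure ν]
    (hH : ∀ (t : Fin T) (ht : 0 < t.val) (a : (Past 𝕏.Ω t × (Past (Info 𝒴) t × Info 𝒴 t)) →ᵇ ℝ),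
      ∫ p, termH 𝕏 t ht a p ∂(π : Measure (Path 𝕏.Ω × Path (Info 𝒴))) = 0)
    (h0 : ∀ t : Fin T, t.val = 0 →
      ((π : Measure (Path 𝕏.Ω × Path (Info 𝒴))).map Prod.snd).map (fun z => z t) =
        ν.map fun z => z t) (t : Fin T) :
    DisintegratesAt (canonicalKernel ν)
      ((π : Measure (Path 𝕏.Ω × Path (Info 𝒴))).map Prod.snd) t := by
  have : IsProbabilityMeasure ((π : Measure (Path 𝕏.Ω × Path (Info 𝒴))).map Prod.snd) :=
    Measure.isProbabilityMeasure_map measurable_snd.aemeasurable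
  rcases Nat.eq_zero_or_pos t.val with ht | ht
  · exact disintegratesAt_of_val_eq_zero ht fun g => by
      rw [canonicalKernel_apply_of_val_eq_zero ν ht, h0 t ht]
  · obtain ⟨b⟩ := (π : Measure (Path 𝕏.Ω × Path (Info 𝒴))).nonempty_of_neZero
    have h := (nonanticipativeAt_of_integral_termH ht (hH t ht) ν).disintegratesAt_restrict
      b.swap MeasurableSet.univ fun _ _ _ _ => Iff.rfl
    rwa [Measure.restrict_univ, map_swap_map_fst] at h

/-- The second marginal of `π` and `ν` have the same first-date law and the same canonical kernels
afterward, so they coincide. Agreement at the first date alone is thus enough to glue the couplings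
of different indices. -/
lemma isCanonicalCoupling_of_integral {ν : Measure (Path (Info 𝒴))} [IsProbabilityMeasure ν]
    (hfst : (π : Measure (Path 𝕏.Ω × Path (Info 𝒴))).map Prod.fst = 𝕏.law)
    (hν : ∀ t, DisintegratesAt (canonicalKernel ν) ν t)
    (hG : ∀ (t : Fin T) (_ : 0 < t.val) (a : ((Past 𝕏.Ω t × 𝕏.Ω t) × Past (Info 𝒴) t) →ᵇ ℝ),
      ∫ p, termG 𝕏 t a p ∂(π : Measure (Path 𝕏.Ω × Path (Info 𝒴))) = 0)
    (hH : ∀ (t : Fin T) (ht : 0 < t.val) (a : (Past 𝕏.Ω t × (Past (Info 𝒴) t × Info 𝒴 t)) →ᵇ ℝ),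
      ∫ p, termH 𝕏 t ht a p ∂(π : Measure (Path 𝕏.Ω × Path (Info 𝒴))) = 0)
    (h0 : ∀ t : Fin T, t.val = 0 →
      ((π : Measure (Path 𝕏.Ω × Path (Info 𝒴))).map Prod.snd).map (fun z => z t) =
        ν.map fun z => z t) :
    IsCanonicalCoupling 𝕏 ν π := by
  have : IsProbabilityMeasure ((π : Measure (Path 𝕏.Ω × Path (Info 𝒴))).map Prod.snd) :=
    Measure.isProbabilityMeasure_map measurable_snd.aemeasurable
  have hd := disintegratesAt_of_integral_termH hH h0
  refine ⟨hfst, eq_of_disintegratesAt hd hν, fun t => ?_, fun t => ?_⟩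
  · rcases Nat.eq_zero_or_pos t.val with ht | ht
    · refine nonanticipativeAt_of_val_eq_zero ht ?_
      rw [hfst]
      exact 𝕏.disintegratesAt t
    · exact nonanticipativeAt_of_integral_termG (hG t ht)
  · rcases Nat.eq_zero_or_pos t.val with ht | ht
    · refine nonanticipativeAt_of_val_eq_zero ht ?_
      rw [map_swap_map_fst]
      exact hd t
    · exact nonanticipativeAt_of_integral_termH ht (hH t ht) ν

lemma IsCanonicalCoupling.mem_bicausalCouplings [∀ t, MeasurableSpace (𝒴 t)]
    [∀ t, BorelSpace (𝒴 t)] {ν : Measure (Path (Info 𝒴))} [IsProbabilityMeasure ν]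
    (hν : ∀ t, DisintegratesAt (canonicalKernel ν) ν t) (h : IsCanonicalCoupling 𝕏 ν π) :
    π ∈ bicausalCouplings 𝕏 (canonicalProcess ν hν) := by
  have : IsProbabilityMeasure ((π : Measure (Path 𝕏.Ω × Path (Info 𝒴))).map Prod.swap) :=
    Measure.isProbabilityMeasure_map measurable_swap.aemeasurable
  exact ⟨⟨h.map_fst, h.map_snd⟩, isCausal_of_nonanticipativeAt h.nonanticipativeAt_fst,
    isCausal_of_nonanticipativeAt h.nonanticipativeAt_snd⟩

end Canonical

/-! ### Minimax over tuples of laws -/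

variable {N : ℕ} (c : Fin N → Path 𝒳 × Path 𝒴 → ℝ) (𝕏 : Fin N → FilteredProcess.{u, v} 𝒳)

/-- The tuples of functions dominated by the costs up to dual functions. -/
def dominatedTuples [NeZero T] : Set (∀ i, (Path (𝕏 i).Ω × Path (Info 𝒴)) →ᵇ ℝ) :=
  {ψ | ∃ g : Fin N → (Info 𝒴 (0 : Fin T) →ᵇ ℝ), (∀ z, ∑ i, g i z = 0) ∧
    ∀ i, ∃ G ∈ testG 𝒴 (𝕏 i), ∃ H ∈ testH 𝒴 (𝕏 i), ∀ ω z,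
      ψ i (ω, z) + g i (z 0) ≤ c i ((𝕏 i).path ω, infoState z) + G ω z + H ω z}

lemma convex_dominatedTuples [NeZero T] : Convex ℝ (dominatedTuples c 𝕏) := by
  rintro ψ ⟨g, hg, h⟩ ψ' ⟨g', hg', h'⟩ a b ha hb hab
  refine ⟨fun i => a • g i + b • g' i, fun z => ?_, fun i => ?_⟩
  · simp [Finset.sum_add_distrib, ← Finset.mul_sum, hg, hg']
  · obtain ⟨G, hG, H, hH, hle⟩ := h i
    obtain ⟨G', hG', H', hH', hle'⟩ := h' i
    refine ⟨_, linear_mem_testG hG hG' a b, _, linear_mem_testH hH hH' a b, fun ω z => ?_⟩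
    have h1 := mul_le_mul_of_nonneg_left (hle ω z) ha
    have h2 := mul_le_mul_of_nonneg_left (hle' ω z) hb
    have h3 : c i ((𝕏 i).path ω, infoState z) = a * c i ((𝕏 i).path ω, infoState z) +
        b * c i ((𝕏 i).path ω, infoState z) := by rw [← add_mul, hab, one_mul]
    rw [h3]
    simp only [Pi.add_apply, Pi.smul_apply, BoundedContinuousFunction.coe_add,
      BoundedContinuousFunction.coe_smul, smul_eq_mul]
    linarith

variable {c 𝕏}

/-- For a fixed `ψ`, minimizing over `z` and then conditioning down to the first date produces an
admissible dual tuple, so the sum of the minimized integrals is at most the dual value. -/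
lemma exists_sum_integral_le [NeZero T] [NeZero N] {ψ : ∀ i, (Path (𝕏 i).Ω × Path (Info 𝒴)) →ᵇ ℝ}
    (hψ : ψ ∈ dominatedTuples c 𝕏) {α : ℝ} (hα : dualValue c 𝕏 < α) :
    ∃ π : ∀ i, ProbabilityMeasure (Path (𝕏 i).Ω × Path (Info 𝒴)),
      (∀ i, (π i : Measure (Path (𝕏 i).Ω × Path (Info 𝒴))).map Prod.fst = (𝕏 i).law) ∧
      ∑ i, ∫ p, ψ i p ∂(π i : Measure (Path (𝕏 i).Ω × Path (Info 𝒴))) ≤ α := by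
  obtain ⟨g, hg, h⟩ := hψ
  choose F hF hFπ using fun i => exists_pointwise_min (𝕏 i).law (ψ i)
  choose f G' hG' hfG' hint using fun i => exists_eq_add_testG (𝒴 := 𝒴) (F i)
  have hf : f ∈ dualPotentials c 𝕏 := by
    refine ⟨g, hg, fun i => ?_⟩
    obtain ⟨G, hG, H, hH, hle⟩ := h i
    -- Since `F i = f i + G' i` and `F i ≤ ψ i`, the new test function is `G - G' i`.
    refine ⟨_, linear_mem_testG hG (hG' i) 1 (-1), H, hH, fun ω z => ?_⟩
    have h1 := hle ω z
    have h2 := hF i ω z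
    have h3 := hfG' i ω z
    linarith
  have hlt : ∑ i, ∫ ω, F i ω ∂(𝕏 i).law < α := by
    have : ((∑ i, ∫ ω, f i (ω 0) ∂(𝕏 i).law : ℝ) : EReal) ≤ dualValue c 𝕏 :=
      le_iSup₂ (f := fun (f : ∀ i, (𝕏 i).Ω 0 →ᵇ ℝ) (_ : f ∈ dualPotentials c 𝕏) =>
        ((∑ i, ∫ ω, f i (ω 0) ∂(𝕏 i).law : ℝ) : EReal)) f hf
    simp only [hint]
    exact_mod_cast this.trans_lt hα
  have hN : (0 : ℝ) < N := Nat.cast_pos.2 (Nat.pos_of_ne_zero (NeZero.ne N))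
  -- The positive gap below `α` is shared equally among the `N` near-minimizers.
  choose π hπ1 hπ2 using fun i => hFπ i ((α - ∑ i, ∫ ω, F i ω ∂(𝕏 i).law) / N)
    (div_pos (sub_pos.2 hlt) hN)
  refine ⟨π, hπ1, (Finset.sum_le_sum fun i _ => hπ2 i).trans ?_⟩
  rw [Finset.sum_add_distrib, Finset.sum_const, Finset.card_univ, Fintype.card_fin, nsmul_eq_mul,
    mul_div_cancel₀ _ hN.ne']
  linarith

/-- The pairing of a tuple of laws with a tuple of functions. -/
noncomputable def pairing (π : ∀ i, ProbabilityMeasure (Path (𝕏 i).Ω × Path (Info 𝒴))) :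
    (∀ i, (Path (𝕏 i).Ω × Path (Info 𝒴)) →ᵇ ℝ) →ₗ[ℝ] ℝ where
  toFun ψ := ∑ i, ∫ p, ψ i p ∂(π i : Measure (Path (𝕏 i).Ω × Path (Info 𝒴)))
  map_add' ψ ψ' := by
    rw [← Finset.sum_add_distrib]
    exact Finset.sum_congr rfl fun i _ => integral_add ((ψ i).integrable _) ((ψ' i).integrable _)
  map_smul' r ψ := by
    rw [RingHom.id_apply, smul_eq_mul, Finset.mul_sum]
    exact Finset.sum_congr rfl fun i _ => integral_const_mul _ _

lemma pairing_apply (π : ∀ i, ProbabilityMeasure (Path (𝕏 i).Ω × Path (Info 𝒴)))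
    (ψ : ∀ i, (Path (𝕏 i).Ω × Path (Info 𝒴)) →ᵇ ℝ) :
    pairing π ψ = ∑ i, ∫ p, ψ i p ∂(π i : Measure (Path (𝕏 i).Ω × Path (Info 𝒴))) := rfl

lemma pairing_single [DecidableEq (Fin N)]
    (π : ∀ i, ProbabilityMeasure (Path (𝕏 i).Ω × Path (Info 𝒴))) (i : Fin N)
    (ψ : (Path (𝕏 i).Ω × Path (Info 𝒴)) →ᵇ ℝ) :
    pairing π (Pi.single i ψ) =
      ∫ p, ψ p ∂(π i : Measure (Path (𝕏 i).Ω × Path (Info 𝒴))) := by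
  rw [pairing_apply, Finset.sum_eq_single i]
  · rw [Pi.single_eq_same]
  · intro j _ hj
    rw [Pi.single_eq_of_ne hj]
    simp
  · simp

/-- Minimax: some tuple of laws realizes all the dual inequalities. -/
lemma exists_forall_pairing_le [NeZero T] [NeZero N] {α : ℝ} (hα : dualValue c 𝕏 < α) :
    ∃ π : ∀ i, ProbabilityMeasure (Path (𝕏 i).Ω × Path (Info 𝒴)),
      (∀ i, (π i : Measure (Path (𝕏 i).Ω × Path (Info 𝒴))).map Prod.fst = (𝕏 i).law) ∧
      ∀ ψ ∈ dominatedTuples c 𝕏, pairing π ψ ≤ α := by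
  let K : Set (∀ i, ProbabilityMeasure (Path (𝕏 i).Ω × Path (Info 𝒴))) :=
    Set.pi univ fun i => {π | (π : Measure (Path (𝕏 i).Ω × Path (Info 𝒴))).map Prod.fst =
      (𝕏 i).law}
  have hK : IsCompact K := isCompact_univ_pi fun i => isCompact_setOf_map_fst_eq (𝕏 i).law
  have hne : K.Nonempty := by
    -- Applied to the zero function merely to produce some law with the prescribed first marginal.
    choose F hF hFπ using fun i => exists_pointwise_min (Z := Path (Info 𝒴)) (𝕏 i).law 0
    choose π hπ1 hπ2 using fun i => hFπ i 1 one_pos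
    exact ⟨π, fun i _ => hπ1 i⟩
  have hconv : Convex ℝ (pairing '' K) := by
    rintro _ ⟨π, hπ, rfl⟩ _ ⟨π', hπ', rfl⟩ a b ha hb hab
    choose ρ hρ using fun i => exists_convexCombination (π i) (π' i) ha hb hab
    refine ⟨ρ, fun i _ => ?_, ?_⟩
    · have h1 := hπ i (mem_univ i)
      have h2 := hπ' i (mem_univ i)
      rw [mem_ofPred_eq] at h1 h2 ⊢
      rw [hρ, Measure.map_add _ _ measurable_fst, Measure.map_smul, Measure.map_smul, h1, h2,
        ← add_smul, ← ENNReal.ofReal_add ha hb, hab, ENNReal.ofReal_one, one_smul]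
    · refine LinearMap.ext fun ψ => ?_
      rw [LinearMap.add_apply, LinearMap.smul_apply, LinearMap.smul_apply, pairing_apply,
        pairing_apply, pairing_apply, smul_eq_mul, smul_eq_mul, Finset.mul_sum, Finset.mul_sum,
        ← Finset.sum_add_distrib]
      refine Finset.sum_congr rfl fun i _ => ?_
      rw [hρ, integral_add_measure (((ψ i).integrable _).smul_measure ENNReal.ofReal_ne_top)
        (((ψ i).integrable _).smul_measure ENNReal.ofReal_ne_top), integral_smul_measure,
        integral_smul_measure, ENNReal.toReal_ofReal ha, ENNReal.toReal_ofReal hb]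
      rfl
  have hcont : ∀ ψ : ∀ i, (Path (𝕏 i).Ω × Path (Info 𝒴)) →ᵇ ℝ,
      Continuous fun π : ∀ i, ProbabilityMeasure (Path (𝕏 i).Ω × Path (Info 𝒴)) => pairing π ψ :=
    fun ψ => by
      simp only [pairing_apply]
      exact continuous_finsetSum _ fun i _ =>
        (ProbabilityMeasure.continuous_integral_boundedContinuousFunction (ψ i)).comp
          (continuous_apply i)
  obtain ⟨π, hπ, h⟩ := exists_forall_le_of_convex hK hne pairing hconv
    (convex_dominatedTuples c 𝕏) hcont (α := α) fun ψ hψ => by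
      obtain ⟨π, hπ, h⟩ := exists_sum_integral_le hψ hα
      exact ⟨π, fun i _ => hπ i, h⟩
  exact ⟨π, fun i => hπ i (mem_univ i), h⟩

lemma eq_zero_of_forall_add_mul_le {x y α : ℝ} (h : ∀ r : ℝ, x + r * y ≤ α) : y = 0 := by
  by_contra hy
  have := h ((α - x + 1) / y)
  rw [div_mul_cancel₀ _ hy] at this
  linarith

end StrongDuality

/-! ### A barycenter from the minimax tuple -/

section StrongDuality

variable {T : ℕ} {𝒳 : Fin T → Type u} [∀ t, TopologicalSpace (𝒳 t)] [∀ t, MeasurableSpace (𝒳 t)]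
  {𝒴 : Fin T → Type w} [∀ t, TopologicalSpace (𝒴 t)] [∀ t, CompactSpace (𝒴 t)]
  [∀ t, MetrizableSpace (𝒴 t)] [∀ t, Nonempty (𝒴 t)] {N : ℕ}
  {c : Fin N → Path 𝒳 × Path 𝒴 → ℝ} {𝕏 : Fin N → FilteredProcess.{u, v} 𝒳}

lemma FilteredProcess.continuous_path (𝕏 : FilteredProcess.{u, v} 𝒳) : Continuous 𝕏.path :=
  continuous_pi fun t => 𝕏.X_continuous t

/-- A bounded continuous function of the paths, as a function on the joint space of a filtered
process and of the canonical process. -/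
noncomputable def pullCost (𝕏 : FilteredProcess.{u, v} 𝒳) (b : (Path 𝒳 × Path 𝒴) →ᵇ ℝ) :
    (Path 𝕏.Ω × Path (Info 𝒴)) →ᵇ ℝ :=
  b.compContinuous ⟨fun p => (𝕏.path p.1, infoState p.2),
    (𝕏.continuous_path.comp continuous_fst).prodMk (continuous_infoState.comp continuous_snd)⟩

/-- A tuple of functions which are annihilated by every optimal tuple of laws. -/
lemma pairing_eq_zero [NeZero T] {α : ℝ}
    {π : ∀ i, ProbabilityMeasure (Path (𝕏 i).Ω × Path (Info 𝒴))}
    (hπ : ∀ ψ ∈ dominatedTuples c 𝕏, pairing π ψ ≤ α) {b : Fin N → (Path 𝒳 × Path 𝒴) →ᵇ ℝ}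
    (hb : ∀ i x, b i x ≤ c i x) (ψ : ∀ i, (Path (𝕏 i).Ω × Path (Info 𝒴)) →ᵇ ℝ)
    (g : Fin N → (Info 𝒴 (0 : Fin T) →ᵇ ℝ)) (hg : ∀ z, ∑ i, g i z = 0)
    (h : ∀ i, ∃ G ∈ testG 𝒴 (𝕏 i), ∃ H ∈ testH 𝒴 (𝕏 i), ∀ ω z,
      ψ i (ω, z) + g i (z 0) = G ω z + H ω z) : pairing π ψ = 0 := by
  -- Adding any real multiple of `ψ` to the minorants `b i` stays in `dominatedTuples`, so an affine
  -- function of `r` is bounded above on the whole line and its slope vanishes.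
  refine eq_zero_of_forall_add_mul_le (x := pairing π fun i => pullCost (𝕏 i) (b i)) (α := α)
    fun r => ?_
  rw [← smul_eq_mul, ← map_smul, ← map_add]
  refine hπ _ ⟨fun i => r • g i, fun z => ?_, fun i => ?_⟩
  · simp [← Finset.mul_sum, hg]
  · obtain ⟨G, hG, H, hH, hle⟩ := h i
    refine ⟨_, linear_mem_testG hG zero_mem_testG r 0, _, linear_mem_testH hH zero_mem_testH r 0,
      fun ω z => ?_⟩
    have h1 := congrArg (r * ·) (hle ω z)
    have h2 : pullCost (𝕏 i) (b i) (ω, z) ≤ c i ((𝕏 i).path ω, infoState z) := hb i _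
    simp only [Pi.add_apply, Pi.smul_apply, BoundedContinuousFunction.coe_add,
      BoundedContinuousFunction.coe_smul, smul_eq_mul] at h1 ⊢
    linarith

/-- Strong duality. -/
lemma barycenterValue_le_dualValue [NeZero T] [NeZero N] [∀ t, MetrizableSpace (𝒳 t)]
    [∀ t, MeasurableSpace (𝒴 t)] [∀ t, BorelSpace (𝒴 t)]
    (hlsc : ∀ i, LowerSemicontinuous (c i)) (hbdd : ∀ i, BddBelow (range (c i))) :
    barycenterValue c 𝕏 ≤ dualValue c 𝕏 := by
  classical
  refine EReal.le_of_forall_lt_iff_le.1 fun α hα => ?_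
  choose b hbc hbm hbt using fun i =>
    exists_monotone_tendsto_of_lowerSemicontinuous (hlsc i) (hbdd i)
  obtain ⟨π, hfst, hπ⟩ := exists_forall_pairing_le hα
  have hzero := pairing_eq_zero hπ (b := fun i => b i 0) fun i x => hbc i 0 x
  have hG : ∀ i (t : Fin T) (_ : 0 < t.val)
      (a : ((Past (𝕏 i).Ω t × (𝕏 i).Ω t) × Past (Info 𝒴) t) →ᵇ ℝ),
      ∫ p, termG (𝕏 i) t a p ∂(π i : Measure (Path (𝕏 i).Ω × Path (Info 𝒴))) = 0 := by
    intro i t ht a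
    rw [← pairing_single]
    refine hzero _ 0 (by simp) fun j => ?_
    rcases eq_or_ne j i with rfl | hj
    · refine ⟨_, single_mem_testG t ht a, _, zero_mem_testH, fun ω z => ?_⟩
      rw [Pi.single_eq_same, termG_apply]
      simp
    · refine ⟨_, zero_mem_testG, _, zero_mem_testH, fun ω z => ?_⟩
      rw [Pi.single_eq_of_ne hj]
      simp
  have hH : ∀ i (t : Fin T) (ht : 0 < t.val)
      (a : (Past (𝕏 i).Ω t × (Past (Info 𝒴) t × Info 𝒴 t)) →ᵇ ℝ),
      ∫ p, termH (𝕏 i) t ht a p ∂(π i : Measure (Path (𝕏 i).Ω × Path (Info 𝒴))) = 0 := by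
    intro i t ht a
    rw [← pairing_single]
    refine hzero _ 0 (by simp) fun j => ?_
    rcases eq_or_ne j i with rfl | hj
    · refine ⟨_, zero_mem_testG, _, single_mem_testH t ht a, fun ω z => ?_⟩
      rw [Pi.single_eq_same, termH_apply]
      simp
    · refine ⟨_, zero_mem_testG, _, zero_mem_testH, fun ω z => ?_⟩
      rw [Pi.single_eq_of_ne hj]
      simp
  have hsnd : ∀ i, IsProbabilityMeasure
      ((π i : Measure (Path (𝕏 i).Ω × Path (Info 𝒴))).map Prod.snd) := fun i =>
    Measure.isProbabilityMeasure_map measurable_snd.aemeasurable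
  let e : ∀ i, (Info 𝒴 (0 : Fin T) →ᵇ ℝ) → ((Path (𝕏 i).Ω × Path (Info 𝒴)) →ᵇ ℝ) := fun i h =>
    h.compContinuous ⟨fun p => p.2 0, by fun_prop⟩
  have hint : ∀ i j (h : Info 𝒴 (0 : Fin T) →ᵇ ℝ),
      ∫ p, e i h p ∂(π i : Measure (Path (𝕏 i).Ω × Path (Info 𝒴))) =
        ∫ p, e j h p ∂(π j : Measure (Path (𝕏 j).Ω × Path (Info 𝒴))) := by
    intro i j h
    rw [← pairing_single, ← pairing_single, ← sub_eq_zero, ← map_sub]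
    -- The function `h` of `z 0` is placed at index `i` and its negative at `j`; this choice of `g`
    -- has zero sum and cancels it, so no test functions are needed.
    refine hzero _ (Pi.single j h - Pi.single i h) (fun z => ?_) fun k => ?_
    · have : ∀ i, ∑ k, (Pi.single i h : Fin N → (Info 𝒴 (0 : Fin T) →ᵇ ℝ)) k z = h z := fun i => by
        rw [Finset.sum_eq_single i]
        · rw [Pi.single_eq_same]
        · intro k _ hk
          rw [Pi.single_eq_of_ne hk]
          rfl
        · simp
      simp only [Pi.sub_apply, BoundedContinuousFunction.coe_sub, Finset.sum_sub_distrib, this,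
        sub_self]
    · refine ⟨_, zero_mem_testG, _, zero_mem_testH, fun ω z => ?_⟩
      have key : ∀ i, (Pi.single i (e i h) : ∀ i, (Path (𝕏 i).Ω × Path (Info 𝒴)) →ᵇ ℝ) k (ω, z) =
          (Pi.single i h : Fin N → (Info 𝒴 (0 : Fin T) →ᵇ ℝ)) k (z 0) := fun i => by
        rcases eq_or_ne k i with rfl | hk
        · rw [Pi.single_eq_same, Pi.single_eq_same]
          rfl
        · rw [Pi.single_eq_of_ne hk, Pi.single_eq_of_ne hk]
          rfl
      simp only [Pi.sub_apply, BoundedContinuousFunction.coe_sub, key]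
      ring
  have hmarg : ∀ i j, ((π i : Measure (Path (𝕏 i).Ω × Path (Info 𝒴))).map Prod.snd).map
        (fun z => z 0) =
      ((π j : Measure (Path (𝕏 j).Ω × Path (Info 𝒴))).map Prod.snd).map fun z => z 0 := by
    intro i j
    have hm : ∀ i, ((π i : Measure (Path (𝕏 i).Ω × Path (Info 𝒴))).map Prod.snd).map
        (fun z => z 0) = (π i : Measure (Path (𝕏 i).Ω × Path (Info 𝒴))).map fun p => p.2 0 :=
      fun i => Measure.map_map (measurable_pi_apply 0) measurable_snd
    rw [hm, hm]
    refine ext_of_forall_integral_eq_of_IsFiniteMeasure fun h => ?_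
    have hi : ∀ i, ∫ x, h x ∂((π i : Measure (Path (𝕏 i).Ω × Path (Info 𝒴))).map fun p => p.2 0) =
        ∫ p, e i h p ∂(π i : Measure (Path (𝕏 i).Ω × Path (Info 𝒴))) := fun i =>
      integral_map ((measurable_pi_apply 0).comp measurable_snd).aemeasurable
        h.continuous.aestronglyMeasurable
    rw [hi, hi]
    exact hint i j h
  -- Any index would do, since the first-date marginals agree by `hmarg`; index `0` exists because
  -- `N` is nonzero.
  let ν : Measure (Path (Info 𝒴)) :=
    (π 0 : Measure (Path (𝕏 0).Ω × Path (Info 𝒴))).map Prod.snd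
  have hν : IsProbabilityMeasure ν := hsnd 0
  have h0 : ∀ i (t : Fin T), t.val = 0 →
      ((π i : Measure (Path (𝕏 i).Ω × Path (Info 𝒴))).map Prod.snd).map (fun z => z t) =
        ν.map fun z => z t := by
    intro i t ht
    obtain rfl : t = 0 := Fin.ext (by simpa using ht)
    exact hmarg i 0
  have hνd : ∀ t, DisintegratesAt (canonicalKernel ν) ν t :=
    disintegratesAt_of_integral_termH (hH 0) (h0 0)
  have hcan : ∀ i, IsCanonicalCoupling (𝕏 i) ν (π i) := fun i =>
    isCanonicalCoupling_of_integral (hfst i) hνd (hG i) (hH i) (h0 i)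
  calc barycenterValue c 𝕏
      ≤ ∑ i, bicausalValue (c i) (𝕏 i) (canonicalProcess ν hνd) := iInf_le _ _
    _ ≤ ∑ i, expectation (π i : Measure (Path (𝕏 i).Ω × Path (Info 𝒴)))
          (fun p => c i ((𝕏 i).path p.1, infoState p.2)) :=
        Finset.sum_le_sum fun i _ => iInf₂_le_of_le (π i) ((hcan i).mem_bicausalCouplings hνd)
          le_rfl
    _ ≤ α := by
        refine sum_expectation_le_of_tendsto
          (fun i => (π i : Measure (Path (𝕏 i).Ω × Path (Info 𝒴))))
          (f := fun i n => pullCost (𝕏 i) (b i n)) (fun i n => (pullCost _ _).integrable _)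
          (fun i p => hbm i _) (fun i p => hbt i _) fun n => ?_
        -- Each approximation of the costs is itself a dominated tuple, with `g`, `G` and `H` all
        -- zero.
        refine hπ (fun i => pullCost (𝕏 i) (b i n)) ⟨0, by simp, fun i =>
          ⟨_, zero_mem_testG, _, zero_mem_testH, fun ω z => ?_⟩⟩
        have : pullCost (𝕏 i) (b i n) (ω, z) ≤ c i ((𝕏 i).path ω, infoState z) := hbc i n _
        simpa using this

end StrongDuality

/-- Without information paths, the dual constraints are void. -/
lemma dualValue_eq_top_of_isEmpty {T N : ℕ} [NeZero T] [NeZero N] {𝒳 : Fin T → Type u}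
    [∀ t, TopologicalSpace (𝒳 t)] [∀ t, MeasurableSpace (𝒳 t)] {𝒴 : Fin T → Type w}
    [∀ t, TopologicalSpace (𝒴 t)] (h : IsEmpty (Path 𝒴)) (c : Fin N → Path 𝒳 × Path 𝒴 → ℝ)
    (𝕏 : Fin N → FilteredProcess.{u, v} 𝒳) : dualValue c 𝕏 = ⊤ := by
  refine EReal.eq_top_iff_forall_lt _ |>.2 fun r => ?_
  have hN : (0 : ℝ) < N := Nat.cast_pos.2 (Nat.pos_of_ne_zero (NeZero.ne N))
  -- The constants add up to `r + 1`, so the dual value exceeds any given `r`.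
  have hf : (fun i => BoundedContinuousFunction.const _ ((r + 1) / N)) ∈ dualPotentials c 𝕏 :=
    ⟨fun _ => 0, by simp, fun i => ⟨_, zero_mem_testG, _, zero_mem_testH, fun ω z =>
      h.elim (infoState z)⟩⟩
  have hle : ((∑ i : Fin N, ∫ ω, BoundedContinuousFunction.const ((𝕏 i).Ω 0) ((r + 1) / (N : ℝ))
      (ω 0) ∂(𝕏 i).law : ℝ) : EReal) ≤ dualValue c 𝕏 :=
    le_iSup₂ (f := fun (f : ∀ i, (𝕏 i).Ω 0 →ᵇ ℝ) (_ : f ∈ dualPotentials c 𝕏) =>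
      ((∑ i, ∫ ω, f i (ω 0) ∂(𝕏 i).law : ℝ) : EReal)) _ hf
  refine lt_of_lt_of_le ?_ hle
  simp only [BoundedContinuousFunction.const_apply, integral_const, probReal_univ, one_smul,
    Finset.sum_const, Finset.card_univ, Fintype.card_fin, nsmul_eq_mul, mul_div_cancel₀ _ hN.ne']
  exact_mod_cast lt_add_one r

end BicausalBarycenter

theorem mainTheorem5 {N T : ℕ} [NeZero N] [NeZero T]
    {𝒳 : Fin T → Type u} [∀ t, TopologicalSpace (𝒳 t)] [∀ t, PolishSpace (𝒳 t)]
    [∀ t, MeasurableSpace (𝒳 t)] [∀ t, BorelSpace (𝒳 t)]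
    {𝒴 : Fin T → Type w} [∀ t, TopologicalSpace (𝒴 t)] [∀ t, PolishSpace (𝒴 t)]
    [∀ t, MeasurableSpace (𝒴 t)] [∀ t, BorelSpace (𝒴 t)] [CompactSpace (∀ t, 𝒴 t)]
    (𝕏 : Fin N → BicausalBarycenter.FilteredProcess.{u, v} 𝒳)
    (c : Fin N → (∀ t, 𝒳 t) × (∀ t, 𝒴 t) → ℝ)
    (hlsc : ∀ i, LowerSemicontinuous (c i))
    (hbdd : ∀ i, BddBelow (Set.range (c i))) :
    BicausalBarycenter.barycenterValue c 𝕏 = BicausalBarycenter.dualValue c 𝕏 := by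
  rcases isEmpty_or_nonempty (∀ t, 𝒴 t) with h | h
  -- If `𝒴` is empty there is no filtered process, because a probability law has a sample path whose
  -- image lies in `𝒴`; the infimum over the empty class is `⊤` as well.
  · rw [BicausalBarycenter.dualValue_eq_top_of_isEmpty h]
    refine iInf_eq_top.2 fun 𝕐 => ?_
    obtain ⟨ω⟩ := 𝕐.law.nonempty_of_neZero
    exact h.elim (𝕐.path ω)
  -- Nonemptiness makes the coordinate projections surjective, so compactness passes from the
  -- product to its factors.
  · have hne : ∀ t, Nonempty (𝒴 t) := fun t => h.map fun y => y t
    have hcpt : ∀ t, CompactSpace (𝒴 t) := fun t =>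
      (Function.surjective_eval t).compactSpace (continuous_apply t)
    exact le_antisymm (BicausalBarycenter.barycenterValue_le_dualValue hlsc hbdd)
      (BicausalBarycenter.dualValue_le_barycenterValue c 𝕏)
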